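/- Let $n\ge 1$, let $Q$ be a finite set with a distinguished quiescent symbol $q_0$, let $W=\mathbb C[Q]$ with orthonormal basis $\{|q\rangle\}_{q\in Q}$, and let $\mathcal H_{\mathcal C}$ be the Hilbert space with orthonormal basis the finite configurations $|c\rangle=\bigotimes_{x\in\mathbb Z^n}|c_x\rangle$ ($c_x\in Q$, $c_x=q_0$ for all but finitely many $x$). Let $\mathcal N\subset\mathbb Z^n$ be finite and $\mathcal N_x=\{k+x:k\in\mathcal N\}$. A bounded operator $R$ on $\mathcal H_{\mathcal C}$ is the global evolution of a QCA with neighborhood $\mathcal N$ if it is unitary, commutes with all translations $\tau_z:\bigotimes_j|c_j\rangle\mapsto\bigotimes_j|c_{j+z}\rangle$, and is causal: for all density operators $\rho,\rho'$ and all $x$, if the partial traces $\rho|_{\mathcal N_x}$ and $\rho'|_{\mathcal N_x}$ agree, then $R\rho R^\dagger|_x=R\rho' R^\dagger|_x$. Let $\mathcal A_x\cong\mathrm{End}(W)$ be the algebra of operators acting on the cell $x$ only, and $\mathcal D_{z,x}=R^\dagger\mathcal A_zR\cap\mathcal A_x$. **Theorem.** A bounded operator $R$ on $\mathcal H_{\mathcal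 C}$ is the global evolution of a QCA with neighborhood $\mathcal N$ and satisfies $\mathcal A_x=\mathrm{span}\big(\prod_{y\in\mathcal N}\mathcal D_{x-y,x}\big)$ for all $x\in\mathbb Z^n$ if and only if $R$ is, up to a global phase, a quantum lattice-gas automaton, in the following sense. There are finite-dimensional Hilbert spaces $\{V_z\}_{z\in\mathcal N}$ and a linear isomorphism $S:W\to\hat W:=\bigotimes_{z\in\mathcal N}V_z$ that preserves inner products (with the tensor product inner product on $\hat W$) and sends $|q_0\rangle$ to a simple tensor $|\hat q_0\rangle=\bigotimes_z|\hat q_{0,z}\rangle$ of unit vectors, such that: (i) for all $x\in\mathbb Z^n$ and $y\in\mathcal N$, $\mathcal D_{x-y,x}$ is the set of operators on the cell $x$ of the form $S^{-1}\big(e\otimes\bigotimes_{z\ne y}\mathbb I_{V_z}\big)S$ with $e\in\mathrm{End}(V_y)$; (ii) $R=\lambda\,\tilde S^{-1}\hat F\sigma\tilde S$, where $\lambda\in\mathbb C$, $|\lambda|=1$, is the eigenvalue of $R$ on the quiescent configuration, $R\bigotimes_x|q_0\rangle=\lambda\bigotimes_x|q_0\rangle$ (so $\lambda=1$ if $R$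 fixes the quiescent configuration); $F$ is a unitary operator on $\hat W$; (iii) $F|\hat q_0\rangle=|\hat q_0\rangle$. Here $\mathcal H_{\hat{\mathcal C}}$ is the Hilbert space of finite configurations with cell space $\hat W$ and quiescent vector $|\hat q_0\rangle$; choosing orthonormal bases of the $V_z$ that contain $|\hat q_{0,z}\rangle$, it has the orthonormal basis $\bigotimes_x\bigotimes_z|\mathbf k_x(z)\rangle$ of product basis vectors equal to $|\hat q_0\rangle$ in all but finitely many cells. The operators $\tilde S:\mathcal H_{\mathcal C}\to\mathcal H_{\hat{\mathcal C}}$ and $\hat F$ on $\mathcal H_{\hat{\mathcal C}}$ are the unitary cell-wise extensions $\bigotimes_x|c_x\rangle\mapsto\bigotimes_xS|c_x\rangle$ and $\bigotimes_x|\hat c_x\rangle\mapsto\bigotimes_xF|\hat c_x\rangle$, and $\sigma$ is the unitary propagation operator $\bigotimes_x\bigotimes_z|\mathbf k_x(z)\rangle\mapsto\bigotimes_x\bigotimes_z|\mathbf k_{x+z}(z)\rangle$. -/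

import Mathlib

open scoped InnerProductSpace TensorProduct

noncomputable section

namespace QCA

/-! ### Configurations and the Hilbert space of finite configurations -/

/-- Finite configurations: maps `c : L → Q` that take the quiescent value `q₀` at all but finitely
many sites. -/
abbrev Config (L : Type*) {Q : Type*} (q₀ : Q) : Type _ :=
  {c : L → Q // {x | c x ≠ q₀}.Finite}

/-- The Hilbert space of finite configurations: `ℓ²` over the set of finite configurations, which
is the completion of their linear span when they are declared orthonormal. -/
abbrev ConfigSpace (L : Type*) {Q : Type*} (q₀ : Q) : Type _ :=
  lp (fun _ : Config L q₀ => ℂ) 2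

/-- Bounded operators on the Hilbert space of finite configurations. -/
abbrev Op (L : Type*) {Q : Type*} (q₀ : Q) : Type _ :=
  ConfigSpace L q₀ →L[ℂ] ConfigSpace L q₀

section Kets

open scoped Classical in
/-- The basis vector `|i⟩` of `ℓ²(ι)`. -/
def l2ket {ι : Type*} (i : ι) : lp (fun _ : ι => ℂ) 2 := lp.single 2 i 1

open scoped Classical in
/-- The symbol basis vector `|q⟩` of the space `ℂ[Q]` of a single cell. -/
def siteKet {Q : Type*} [Fintype Q] (q : Q) : EuclideanSpace ℂ Q := EuclideanSpace.single q 1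

open scoped Classical in
theorem l2ket_apply {ι : Type*} (i j : ι) : l2ket i j = if j = i then 1 else 0 := by
  simp [l2ket, Pi.single_apply]

open scoped Classical in
theorem siteKet_apply {Q : Type*} [Fintype Q] (q r : Q) :
    siteKet q r = if r = q then 1 else 0 := by
  simp [siteKet]

theorem inner_l2ket_left {ι : Type*} (i : ι) (f : lp (fun _ : ι => ℂ) 2) :
    ⟪l2ket i, f⟫_ℂ = f i := by
  classical
  have := lp.inner_single_left (𝕜 := ℂ) (G := fun _ : ι => ℂ) i (1 : ℂ) f
  simp only [l2ket]
  convert this using 1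
  simp

theorem inner_siteKet_left {Q : Type*} [Fintype Q] (q : Q) (v : EuclideanSpace ℂ Q) :
    ⟪siteKet q, v⟫_ℂ = v q := by
  classical
  simp [siteKet, EuclideanSpace.inner_single_left]

theorem orthonormal_l2ket {ι : Type*} :
    Orthonormal ℂ (fun i : ι => (l2ket i : lp (fun _ : ι => ℂ) 2)) := by
  classical
  rw [orthonormal_iff_ite]
  intro i j
  rw [inner_l2ket_left, l2ket_apply]

end Kets

/-- The basis vector `|c⟩` given by a finite configuration. -/
abbrev ket {L Q : Type*} {q₀ : Q} (c : Config L q₀) : ConfigSpace L q₀ := l2ket c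

/-- The all-quiescent configuration. -/
def vac (L : Type*) {Q : Type*} (q₀ : Q) : Config L q₀ := ⟨fun _ => q₀, by simp⟩

/-! ### Unitaries given by their values on the configuration basis -/

section Unitaries

variable {ι κ : Type*}

/-- The isometry with `|i⟩ ↦ v i`, for an orthonormal family `v`. -/
def isometryOfBasis (v : ι → lp (fun _ : κ => ℂ) 2) (hv : Orthonormal ℂ v) :
    lp (fun _ : ι => ℂ) 2 →ₗᵢ[ℂ] lp (fun _ : κ => ℂ) 2 :=
  hv.orthogonalFamily.linearIsometry

theorem isometryOfBasis_ket (v : ι → lp (fun _ : κ => ℂ) 2) (hv : Orthonormal ℂ v) (i : ι) :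
    isometryOfBasis v hv (l2ket i) = v i := by
  classical
  have := hv.orthogonalFamily.linearIsometry_apply_single (i := i) (1 : ℂ)
  simp only [l2ket, isometryOfBasis]
  convert this using 1
  simp

theorem hasSum_l2ket (f : lp (fun _ : ι => ℂ) 2) : HasSum (fun i => f i • l2ket i) f := by
  classical
  have := lp.hasSum_single (E := fun _ : ι => ℂ) (p := 2) (by simp) f
  convert this using 2 with i
  rw [l2ket, ← lp.single_smul]
  simp

theorem isometry_mutual (v : ι → lp (fun _ : κ => ℂ) 2) (hv : Orthonormal ℂ v)
    (w : κ → lp (fun _ : ι => ℂ) 2) (hw : Orthonormal ℂ w)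
    (h : ∀ i j, v i j = star (w j i)) (f : lp (fun _ : κ => ℂ) 2) :
    isometryOfBasis v hv (isometryOfBasis w hw f) = f := by
  have key : ∀ (g : lp (fun _ : ι => ℂ) 2) (j : κ),
      isometryOfBasis v hv g j = ⟪w j, g⟫_ℂ := by
    intro g j
    have h1 := (hasSum_l2ket g).mapL ((innerSL ℂ (l2ket j : lp (fun _ : κ => ℂ) 2)).comp
      (isometryOfBasis v hv).toContinuousLinearMap)
    have h2 := (hasSum_l2ket g).mapL (innerSL ℂ (w j))
    have e : (fun i => ((innerSL ℂ (l2ket j : lp (fun _ : κ => ℂ) 2)).comp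
        (isometryOfBasis v hv).toContinuousLinearMap) (g i • l2ket i)) =
        fun i => innerSL ℂ (w j) (g i • l2ket i) := by
      funext i
      have hr : ⟪w j, l2ket i⟫_ℂ = star (w j i) := by
        rw [← inner_conj_symm, inner_l2ket_left]; rfl
      simp [isometryOfBasis_ket, inner_l2ket_left, hr, h]
    rw [e] at h1
    have := h1.unique h2
    simpa [inner_l2ket_left] using this
  apply lp.ext
  funext j
  rw [key, ← isometryOfBasis_ket w hw j, LinearIsometry.inner_map_map, inner_l2ket_left]

/-- The unitary with `|i⟩ ↦ v i`, whose inverse has `|j⟩ ↦ w j`. -/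
def unitaryOfBasis (v : ι → lp (fun _ : κ => ℂ) 2) (hv : Orthonormal ℂ v)
    (w : κ → lp (fun _ : ι => ℂ) 2) (hw : Orthonormal ℂ w)
    (h : ∀ i j, v i j = star (w j i)) :
    lp (fun _ : ι => ℂ) 2 ≃ₗᵢ[ℂ] lp (fun _ : κ => ℂ) 2 :=
  { (isometryOfBasis v hv) with
    invFun := isometryOfBasis w hw
    left_inv := fun f => isometry_mutual w hw v hv (fun i j => by rw [h]; simp) f
    right_inv := fun f => isometry_mutual v hv w hw h f }

theorem unitaryOfBasis_ket (v : ι → lp (fun _ : κ => ℂ) 2) (hv : Orthonormal ℂ v)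
    (w : κ → lp (fun _ : ι => ℂ) 2) (hw : Orthonormal ℂ w)
    (h : ∀ i j, v i j = star (w j i)) (i : ι) :
    unitaryOfBasis v hv w hw h (l2ket i) = v i :=
  isometryOfBasis_ket v hv i

/-- The unitary that permutes the basis vectors: `|i⟩ ↦ |e i⟩`. -/
def permUnitary (e : ι ≃ κ) : lp (fun _ : ι => ℂ) 2 ≃ₗᵢ[ℂ] lp (fun _ : κ => ℂ) 2 :=
  unitaryOfBasis (fun i => l2ket (e i)) (orthonormal_l2ket.comp e e.injective)
    (fun j => l2ket (e.symm j)) (orthonormal_l2ket.comp e.symm e.symm.injective)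
    (fun i j => by
      classical
      simp only [l2ket_apply, Equiv.eq_symm_apply]
      by_cases hij : j = e i
      · simp [hij]
      · simp [hij, Ne.symm hij])

theorem permUnitary_ket (e : ι ≃ κ) (i : ι) : permUnitary e (l2ket i) = l2ket (e i) :=
  unitaryOfBasis_ket _ _ _ _ _ i

/-- The orthogonal projection onto the closed span of the basis vectors `|i⟩` with `i ∈ s`. -/
def basisProj (s : Set ι) : lp (fun _ : ι => ℂ) 2 →L[ℂ] lp (fun _ : ι => ℂ) 2 :=
  LinearMap.mkContinuous
    { toFun := fun f => ⟨s.indicator f, (lp.memℓp f).mono' (fun i => by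
        by_cases hi : i ∈ s <;> simp [hi])⟩
      map_add' := fun f g => by
        apply lp.ext
        exact Set.indicator_add s f g
      map_smul' := fun a f => by
        apply lp.ext
        exact Set.indicator_const_smul s a f } 1
    (fun f => by
      rw [one_mul]
      refine lp.norm_mono (by simp) fun i => ?_
      by_cases hi : i ∈ s <;> simp [hi])

theorem basisProj_apply (s : Set ι) (f : lp (fun _ : ι => ℂ) 2) (i : ι) :
    basisProj s f i = s.indicator f i := rfl

end Unitaries

/-! ### Product vectors and cell-wise unitaries -/

section CellWise

variable {L Q Q' : Type*} {q₀ : Q} {q₀' : Q'}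

open scoped Classical in
/-- The extension by the quiescent symbol of a finite pattern to a finite configuration. -/
def extendPattern (q₀ : Q) (A : Finset L) (g : A → Q) : Config L q₀ :=
  ⟨fun x => if h : x ∈ A then g ⟨x, h⟩ else q₀, A.finite_toSet.subset fun x hx => by
    by_contra h
    exact hx (dif_neg h)⟩

theorem extendPattern_mem (A : Finset L) (g : A → Q) (x : A) :
    (extendPattern q₀ A g).1 x = g x := by
  simp [extendPattern]

theorem extendPattern_injective (A : Finset L) :
    Function.Injective (extendPattern q₀ A) := by
  intro g g' h
  funext x
  rw [← extendPattern_mem (q₀ := q₀) A g x, h, extendPattern_mem]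

theorem mem_range_extendPattern (A : Finset L) (c : Config L q₀) (hc : ∀ x, x ∉ A → c.1 x = q₀) :
    c ∈ Set.range (extendPattern q₀ A) := by
  refine ⟨fun x => c.1 x, Subtype.ext (funext fun x => ?_)⟩
  by_cases h : x ∈ A
  · simp [extendPattern, h]
  · simp [extendPattern, h, hc x h]

variable [Fintype Q] [Fintype Q']

/-- The coordinate at the configuration `c` of the product vector `⨂ₓ ψ x`. -/
def prodCoord (ψ : L → EuclideanSpace ℂ Q) (c : L → Q) : ℂ := ∏ᶠ x, ψ x (c x)

theorem prodCoord_eq_prod (ψ : L → EuclideanSpace ℂ Q) (A : Finset L)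
    (hA : ∀ x, x ∉ A → ψ x = siteKet q₀) (c : Config L q₀) (hc : ∀ x, x ∉ A → c.1 x = q₀) :
    prodCoord ψ c.1 = ∏ x ∈ A, ψ x (c.1 x) := by
  refine finprod_eq_prod_of_mulSupport_subset _ fun x hx => ?_
  by_contra h
  refine hx ?_
  rw [Finset.mem_coe] at h
  simp only [hA x h, hc x h, siteKet_apply, if_true]

theorem prodCoord_eq_zero (ψ : L → EuclideanSpace ℂ Q) (A : Finset L)
    (hA : ∀ x, x ∉ A → ψ x = siteKet q₀) (c : Config L q₀) (x : L) (hx : x ∉ A)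
    (hc : c.1 x ≠ q₀) : prodCoord ψ c.1 = 0 := by
  classical
  have hfin : (Function.mulSupport fun x => ψ x (c.1 x)).Finite := by
    refine (A.finite_toSet.union c.2).subset fun y hy => ?_
    by_contra h
    simp only [Set.mem_union, Finset.mem_coe, not_or] at h
    have h2 : c.1 y = q₀ := by
      by_contra h3
      exact h.2 h3
    exact hy (by simp only [hA y h.1, h2, siteKet_apply, if_true])
  have h0 : ψ x (c.1 x) = 0 := by rw [hA x hx, siteKet_apply, if_neg hc]
  rw [prodCoord, finprod_eq_prod_of_mulSupport_subset (s := insert x hfin.toFinset) _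
    (fun y hy => by simpa using Or.inr hy)]
  exact Finset.prod_eq_zero (Finset.mem_insert_self _ _) h0

theorem prodCoord_support (ψ : L → EuclideanSpace ℂ Q) (A : Finset L)
    (hA : ∀ x, x ∉ A → ψ x = siteKet q₀) (c : Config L q₀) (h : prodCoord ψ c.1 ≠ 0) :
    c ∈ Set.range (extendPattern q₀ A) :=
  mem_range_extendPattern A c fun x hx => by
    by_contra hc
    exact h (prodCoord_eq_zero ψ A hA c x hx hc)

/-- The product vector `⨂ₓ ψ x`, where all but finitely many of the `ψ x` are `|q₀⟩`. -/
def prodVec (ψ : L → EuclideanSpace ℂ Q) (hψ : {x | ψ x ≠ siteKet q₀}.Finite) :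
    ConfigSpace L q₀ :=
  ⟨fun c => prodCoord ψ c.1, by
    refine (memℓp_zero ?_).of_exponent_ge (zero_le (a := (2 : ENNReal)))
    refine (Set.finite_range (extendPattern q₀ hψ.toFinset)).subset fun c hc => ?_
    exact prodCoord_support ψ hψ.toFinset (fun x hx => by simpa using hx) c hc⟩

theorem prodVec_apply (ψ : L → EuclideanSpace ℂ Q) (hψ : {x | ψ x ≠ siteKet q₀}.Finite)
    (c : Config L q₀) : prodVec ψ hψ c = ∏ᶠ x, ψ x (c.1 x) := rfl

/-- `⟪⨂ₓ ψ x, ⨂ₓ φ x⟫ = ∏ₓ ⟪ψ x, φ x⟫`. -/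
theorem inner_prodVec (ψ φ : L → EuclideanSpace ℂ Q) (hψ : {x | ψ x ≠ siteKet q₀}.Finite)
    (hφ : {x | φ x ≠ siteKet q₀}.Finite) (A : Finset L)
    (hA : ∀ x, x ∉ A → ψ x = siteKet q₀) (hA' : ∀ x, x ∉ A → φ x = siteKet q₀) :
    ⟪prodVec ψ hψ, prodVec φ hφ⟫_ℂ = ∏ x ∈ A, ⟪ψ x, φ x⟫_ℂ := by
  classical
  rw [lp.inner_eq_tsum, ← (extendPattern_injective (q₀ := q₀) A).tsum_eq, tsum_fintype,
    ← Finset.prod_coe_sort]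
  · simp only [PiLp.inner_apply]
    rw [Finset.prod_univ_sum, Fintype.piFinset_univ]
    refine Finset.sum_congr rfl fun g _ => ?_
    have hc : ∀ x, x ∉ A → (extendPattern q₀ A g).1 x = q₀ := fun x hx => by
      simp [extendPattern, hx]
    change inner ℂ (prodCoord ψ (extendPattern q₀ A g).1) (prodCoord φ (extendPattern q₀ A g).1) = _
    rw [prodCoord_eq_prod ψ A hA _ hc, prodCoord_eq_prod φ A hA' _ hc]
    simp only [RCLike.inner_apply, map_prod, ← Finset.prod_mul_distrib]
    rw [← Finset.prod_coe_sort]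
    simp only [extendPattern_mem]
  · intro c hc
    refine prodCoord_support ψ A hA c fun h => hc ?_
    change inner ℂ (prodCoord ψ c.1) _ = 0
    simp [h]

theorem finite_image_ne (U : EuclideanSpace ℂ Q ≃ₗᵢ[ℂ] EuclideanSpace ℂ Q')
    (hU : U (siteKet q₀) = siteKet q₀') (c : Config L q₀) :
    {x | U (siteKet (c.1 x)) ≠ siteKet q₀'}.Finite :=
  c.2.subset fun x hx h => hx (by rw [h, hU])

/-- The vector `⨂ₓ U |c x⟩`. -/
def imageVec (U : EuclideanSpace ℂ Q ≃ₗᵢ[ℂ] EuclideanSpace ℂ Q')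
    (hU : U (siteKet q₀) = siteKet q₀') (c : Config L q₀) : ConfigSpace L q₀' :=
  prodVec (fun x => U (siteKet (c.1 x))) (finite_image_ne U hU c)

theorem orthonormal_imageVec (U : EuclideanSpace ℂ Q ≃ₗᵢ[ℂ] EuclideanSpace ℂ Q')
    (hU : U (siteKet q₀) = siteKet q₀') :
    Orthonormal ℂ (imageVec (L := L) U hU) := by
  classical
  rw [orthonormal_iff_ite]
  intro c c'
  have hA : ∀ x, x ∉ c.2.toFinset ∪ c'.2.toFinset → c.1 x = q₀ ∧ c'.1 x = q₀ := by
    intro x hx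
    simpa using hx
  rw [imageVec, imageVec, inner_prodVec _ _ _ _ (c.2.toFinset ∪ c'.2.toFinset)
    (fun x hx => by rw [(hA x hx).1, hU]) (fun x hx => by rw [(hA x hx).2, hU])]
  simp only [LinearIsometryEquiv.inner_map_map, inner_siteKet_left, siteKet_apply]
  rw [Finset.prod_ite_zero]
  simp only [Finset.prod_const_one]
  refine if_congr ⟨fun h => Subtype.ext (funext fun x => ?_), fun h x _ => by rw [h]⟩ rfl rfl
  by_cases hx : x ∈ c.2.toFinset ∪ c'.2.toFinset
  · exact h x hx
  · rw [(hA x hx).1, (hA x hx).2]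

/-- The cell-wise extension `⨂ₓ |c x⟩ ↦ ⨂ₓ U |c x⟩` of a unitary `U` between cell spaces that
respects the quiescent symbols. -/
def cellwise (L : Type*) (U : EuclideanSpace ℂ Q ≃ₗᵢ[ℂ] EuclideanSpace ℂ Q')
    (hU : U (siteKet q₀) = siteKet q₀') : ConfigSpace L q₀ ≃ₗᵢ[ℂ] ConfigSpace L q₀' :=
  have hU' : U.symm (siteKet q₀') = siteKet q₀ := by rw [← hU, U.symm_apply_apply]
  unitaryOfBasis (imageVec U hU) (orthonormal_imageVec U hU)
    (imageVec U.symm hU') (orthonormal_imageVec U.symm hU') (fun c c' => by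
      classical
      change prodCoord (fun x => U (siteKet (c.1 x))) c'.1 =
        star (prodCoord (fun x => U.symm (siteKet (c'.1 x))) c.1)
      have hA : ∀ x, x ∉ c.2.toFinset ∪ c'.2.toFinset → c.1 x = q₀ ∧ c'.1 x = q₀' := by
        intro x hx
        simpa using hx
      rw [prodCoord_eq_prod _ (c.2.toFinset ∪ c'.2.toFinset)
          (fun x hx => by rw [(hA x hx).1, hU]) _ (fun x hx => (hA x hx).2),
        prodCoord_eq_prod _ (c.2.toFinset ∪ c'.2.toFinset)
          (fun x hx => by rw [(hA x hx).2, hU']) _ (fun x hx => (hA x hx).1), star_prod]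
      refine Finset.prod_congr rfl fun x _ => ?_
      rw [← inner_siteKet_left, ← inner_siteKet_left (c.1 x), ← starRingEnd_apply,
        inner_conj_symm, ← U.inner_map_map, U.apply_symm_apply])

theorem cellwise_ket (U : EuclideanSpace ℂ Q ≃ₗᵢ[ℂ] EuclideanSpace ℂ Q')
    (hU : U (siteKet q₀) = siteKet q₀') (c : Config L q₀) :
    cellwise L U hU (ket c) =
      prodVec (fun x => U (siteKet (c.1 x))) (finite_image_ne U hU c) :=
  isometryOfBasis_ket (imageVec U hU) (orthonormal_imageVec U hU) c

end CellWise

/-! ### Operators on a single cell -/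

section CellOperators

variable {L Q : Type*} [DecidableEq L] {q₀ : Q}

/-- Apply a permutation of the symbols to the value at the site `x`. -/
def permAt (x : L) (e : Equiv.Perm Q) : Config L q₀ ≃ Config L q₀ where
  toFun c := ⟨Function.update c.1 x (e (c.1 x)), (c.2.insert x).subset fun y hy => by
    by_cases h : y = x
    · exact Or.inl h
    · exact Or.inr (by simpa [Function.update_of_ne h] using hy)⟩
  invFun c := ⟨Function.update c.1 x (e.symm (c.1 x)), (c.2.insert x).subset fun y hy => by
    by_cases h : y = x
    · exact Or.inl h
    · exact Or.inr (by simpa [Function.update_of_ne h] using hy)⟩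
  left_inv c := by simp
  right_inv c := by simp

/-- Replace the value at the site `x` by `q`. -/
def setAt (c : Config L q₀) (x : L) (q : Q) : Config L q₀ :=
  ⟨Function.update c.1 x q, (c.2.insert x).subset fun y hy => by
    by_cases h : y = x
    · exact Or.inl h
    · exact Or.inr (by simpa [Function.update_of_ne h] using hy)⟩

open scoped Classical in
/-- The matrix unit `|r⟩⟨q|` acting on the cell `x`, and as the identity on all other cells. -/
def cellUnit (x : L) (r q : Q) : Op L q₀ :=
  (permUnitary (permAt (q₀ := q₀) x (Equiv.swap q r))).toContinuousLinearEquiv.toContinuousLinearMap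
    ∘L basisProj {c | c.1 x = q}

open scoped Classical in
theorem cellUnit_ket (x : L) (r q : Q) (c : Config L q₀) :
    cellUnit x r q (ket c) = if c.1 x = q then ket (setAt c x r) else 0 := by
  have h : basisProj {c : Config L q₀ | c.1 x = q} (l2ket c) =
      if c.1 x = q then l2ket c else 0 := by
    apply lp.ext
    funext c'
    rw [basisProj_apply]
    by_cases hc' : c' = c
    · subst hc'
      by_cases hx : c'.1 x = q <;> simp [Set.indicator, hx]
    · by_cases hx : c.1 x = q <;> simp [Set.indicator, hx, l2ket_apply, hc']
  rw [cellUnit, ContinuousLinearMap.comp_apply, h]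
  split_ifs with hx
  · change permUnitary _ (l2ket c) = _
    rw [permUnitary_ket]
    congr 1
    apply Subtype.ext
    simp [permAt, setAt, hx]
  · simp

variable [Fintype Q]

/-- The embedding `A ↦ A ⊗ 𝕀` of `End(W)`, `W = ℂ[Q]`, as the operators acting on the cell `x`. -/
def cellOp (x : L) (A : EuclideanSpace ℂ Q →ₗ[ℂ] EuclideanSpace ℂ Q) : Op L q₀ :=
  ∑ r : Q, ∑ q : Q, (A (siteKet q) r) • cellUnit x r q

theorem cellOp_ket (x : L) (A : EuclideanSpace ℂ Q →ₗ[ℂ] EuclideanSpace ℂ Q) (c : Config L q₀) :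
    cellOp x A (ket c) = ∑ r : Q, (A (siteKet (c.1 x)) r) • ket (setAt c x r) := by
  classical
  simp [cellOp, cellUnit_ket]

/-- The algebra `𝒜ₓ` of operators local upon the cell `x`. -/
def cellAlgebra (q₀ : Q) (x : L) : Set (Op L q₀) := Set.range (cellOp x)

/-- The image `ℛ_z = R† 𝒜_z R` of the cell algebra `𝒜_z`. -/
def imageAlgebra (R : Op L q₀) (z : L) : Set (Op L q₀) :=
  {T | ∃ A ∈ cellAlgebra q₀ z, T = ContinuousLinearMap.adjoint R ∘L A ∘L R}

/-- The algebra `𝒟_{z,x} = ℛ_z ∩ 𝒜ₓ`. -/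
def localPiece (R : Op L q₀) (z x : L) : Set (Op L q₀) :=
  imageAlgebra R z ∩ cellAlgebra q₀ x

end CellOperators

/-! ### States, restrictions, and quantum cellular automata -/

section States

variable {L Q : Type*} [DecidableEq L] {q₀ : Q}

/-- Density operators: positive operators of trace one. (For a positive operator, convergence of
the sum of its diagonal entries in one orthonormal basis is the trace class property, and the sum
is the trace.) -/
def IsDensity (ρ : Op L q₀) : Prop :=
  ρ.IsPositive ∧ HasSum (fun c : Config L q₀ => ⟪ket c, ρ (ket c)⟫_ℂ) 1

/-- The configuration that is `a` on `D` and `w` off `D`. -/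
def glue (D : Finset L) (a : D → Q) (w : Config {x // x ∉ D} q₀) : Config L q₀ :=
  ⟨fun x => if h : x ∈ D then a ⟨x, h⟩ else w.1 ⟨x, h⟩,
    (D.finite_toSet.union (w.2.image Subtype.val)).subset fun x hx => by
      by_cases h : x ∈ D
      · exact Or.inl h
      · refine Or.inr ⟨⟨x, h⟩, ?_, rfl⟩
        simpa [h] using hx⟩

/-- The restriction `ρ|_D`, the partial trace of `ρ` over the cells outside `D`, as a matrix in the
configuration basis of `⨂_{x ∈ D} W`. -/
def restrict (D : Finset L) (ρ : Op L q₀) : Matrix (D → Q) (D → Q) ℂ :=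
  fun a b => ∑' w : Config {x // x ∉ D} q₀, ⟪ket (glue D a w), ρ (ket (glue D b w))⟫_ℂ

end States

section Automata

variable {n : ℕ} {Q : Type*} {q₀ : Q}

/-- The neighborhood `𝒩ₓ = {k + x : k ∈ 𝒩}` of the cell `x`. -/
def nbhd (N : Finset (Fin n → ℤ)) (x : Fin n → ℤ) : Finset (Fin n → ℤ) :=
  N.image fun k => k + x

/-- The translation of configurations, `(c_j)_j ↦ (c_{j+z})_j`. -/
def shift (q₀ : Q) (z : Fin n → ℤ) : Config (Fin n → ℤ) q₀ ≃ Config (Fin n → ℤ) q₀ where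
  toFun c := ⟨fun j => c.1 (j + z), c.2.preimage (add_left_injective z).injOn⟩
  invFun c := ⟨fun j => c.1 (j - z), c.2.preimage (sub_left_injective (b := z)).injOn⟩
  left_inv c := by simp
  right_inv c := by simp

/-- The translation operator `τ_z`. -/
def translation (q₀ : Q) (z : Fin n → ℤ) :
    ConfigSpace (Fin n → ℤ) q₀ ≃ₗᵢ[ℂ] ConfigSpace (Fin n → ℤ) q₀ :=
  permUnitary (shift q₀ z)

/-- `τ_z M τ_z⁻¹ = M` for all `z`. -/
def IsTranslationInvariant (M : Op (Fin n → ℤ) q₀) : Prop :=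
  ∀ (z : Fin n → ℤ) (f : ConfigSpace (Fin n → ℤ) q₀),
    translation q₀ z (M ((translation q₀ z).symm f)) = M f

/-- Causality relative to the neighborhood `N`: for density operators, the restriction of `M ρ M†`
to a cell `x` is determined by the restriction of `ρ` to the neighborhood of `x`. -/
def IsCausal (N : Finset (Fin n → ℤ)) (M : Op (Fin n → ℤ) q₀) : Prop :=
  ∀ ρ ρ' : Op (Fin n → ℤ) q₀, IsDensity ρ → IsDensity ρ' → ∀ x : Fin n → ℤ,
    restrict (nbhd N x) ρ = restrict (nbhd N x) ρ' →
      restrict {x} (M ∘L ρ ∘L ContinuousLinearMap.adjoint M) =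
        restrict {x} (M ∘L ρ' ∘L ContinuousLinearMap.adjoint M)

/-- `R` is the global evolution of a quantum cellular automaton with neighborhood `N`. -/
structure IsQCA (N : Finset (Fin n → ℤ)) (R : Op (Fin n → ℤ) q₀) : Prop where
  isUnitary : R ∈ unitary (Op (Fin n → ℤ) q₀)
  translationInvariant : IsTranslationInvariant R
  causal : IsCausal N R

/-- The local condition `𝒜ₓ = span (∏_{y ∈ N} 𝒟_{x-y,x})` at every cell `x`. The order of the
factors is immaterial for unitary `R`: algebras `𝒟_{x-y,x}` with distinct `y` commute. -/
def LocalCondition [Fintype Q] (N : Finset (Fin n → ℤ)) (R : Op (Fin n → ℤ) q₀) : Prop :=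
  ∀ x : Fin n → ℤ, cellAlgebra q₀ x =
    (Submodule.span ℂ {T : Op (Fin n → ℤ) q₀ | ∃ t : (Fin n → ℤ) → Op (Fin n → ℤ) q₀,
      (∀ y ∈ N, t y ∈ localPiece R (x - y) x) ∧ T = (N.toList.map t).prod} :
        Set (Op (Fin n → ℤ) q₀))

end Automata

/-! ### Lattice gases: cells that are tensor products of components -/

section Components

variable {ι : Type*} [Fintype ι]

/-- The component space `V_z = ℂ^{d z}`. -/
abbrev Component (d : ι → ℕ) (z : ι) : Type := EuclideanSpace ℂ (Fin (d z))

/-- The labels `𝐤 ∈ ∏_z {0, …, d z - 1}` of the product basis of `⨂_z V_z`. -/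
abbrev Label (d : ι → ℕ) : Type _ := (z : ι) → Fin (d z)

/-- The Hilbert space `Ŵ = ⨂_z V_z` with its tensor product inner product, presented in the
orthonormal basis of the product vectors `⨂_z |𝐤 z⟩`. -/
abbrev CellSpace (d : ι → ℕ) : Type _ := EuclideanSpace ℂ (Label d)

/-- The identification of `⨂_z V_z` with `Ŵ`, which sends `⨂_z |𝐤 z⟩` to `|𝐤⟩`. -/
def tensorCoord (d : ι → ℕ) : (⨂[ℂ] z, Component d z) ≃ₗ[ℂ] CellSpace d :=
  (Basis.piTensorProduct fun z =>
    (EuclideanSpace.basisFun (Fin (d z)) ℂ).toBasis).equivFun ≪≫ₗ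
      (WithLp.linearEquiv 2 ℂ (Label d → ℂ)).symm

theorem tensorCoord_tprod (d : ι → ℕ) (v : (z : ι) → Component d z) (k : Label d) :
    tensorCoord d (PiTensorProduct.tprod ℂ v) k = ∏ z, v z (k z) := by
  simp [tensorCoord, Basis.piTensorProduct_repr_tprod_apply]

variable [DecidableEq ι]

theorem tensorCoord_siteKet (d : ι → ℕ) (k : Label d) :
    tensorCoord d (PiTensorProduct.tprod ℂ fun z => siteKet (k z)) = siteKet k := by
  classical
  ext j
  rw [tensorCoord_tprod]
  simp only [siteKet_apply, funext_iff]
  convert Finset.prod_ite_zero (s := Finset.univ) (p := fun z => j z = k z)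
    (f := fun _ => (1 : ℂ)) using 1
  · refine Finset.prod_congr rfl fun z _ => ?_
    congr
  · simp

theorem inner_tensorCoord (d : ι → ℕ) (v w : (z : ι) → Component d z) :
    ⟪tensorCoord d (PiTensorProduct.tprod ℂ v), tensorCoord d (PiTensorProduct.tprod ℂ w)⟫_ℂ =
      ∏ z, ⟪v z, w z⟫_ℂ := by
  simp only [PiLp.inner_apply, tensorCoord_tprod]
  rw [Finset.prod_univ_sum, Fintype.piFinset_univ]
  simp [Finset.prod_mul_distrib]

/-- The operator `e ⊗ ⨂_{z ≠ y} 𝕀` on `Ŵ = ⨂_z V_z`. -/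
def onComponent (d : ι → ℕ) (y : ι) (e : Component d y →ₗ[ℂ] Component d y) :
    CellSpace d →ₗ[ℂ] CellSpace d :=
  (tensorCoord d).toLinearMap ∘ₗ
    PiTensorProduct.map (Function.update (fun z => (LinearMap.id : Component d z →ₗ[ℂ] _)) y e) ∘ₗ
      (tensorCoord d).symm.toLinearMap

theorem onComponent_tprod (d : ι → ℕ) (y : ι) (e : Component d y →ₗ[ℂ] Component d y)
    (v : (z : ι) → Component d z) :
    onComponent d y e (tensorCoord d (PiTensorProduct.tprod ℂ v)) =
      tensorCoord d (PiTensorProduct.tprod ℂ (Function.update v y (e (v y)))) := by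
  simp only [onComponent, LinearMap.comp_apply, LinearEquiv.coe_coe,
    LinearEquiv.symm_apply_apply, PiTensorProduct.map_tprod]
  congr 2
  funext z
  by_cases h : z = y
  · subst h
    simp
  · simp [Function.update_of_ne h]

end Components

section Propagation

variable {n : ℕ} {N : Finset (Fin n → ℤ)} {K : N → Type*}

/-- Propagation of configurations: the `z`-th component of the cell `x + z` moves to the `z`-th
component of the cell `x`. -/
def propagate (k₀ : (z : N) → K z) : Config (Fin n → ℤ) k₀ ≃ Config (Fin n → ℤ) k₀ where
  toFun c := ⟨fun x z => c.1 (x + z.1) z, by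
    refine (Set.finite_iUnion fun z : N =>
      c.2.preimage (add_left_injective z.1).injOn).subset fun x hx => ?_
    obtain ⟨z, hz⟩ := Function.ne_iff.1 hx
    exact Set.mem_iUnion.2 ⟨z, fun h => hz (congrFun h z)⟩⟩
  invFun c := ⟨fun x z => c.1 (x - z.1) z, by
    refine (Set.finite_iUnion fun z : N =>
      c.2.preimage (sub_left_injective (b := z.1)).injOn).subset fun x hx => ?_
    obtain ⟨z, hz⟩ := Function.ne_iff.1 hx
    exact Set.mem_iUnion.2 ⟨z, fun h => hz (congrFun h z)⟩⟩
  left_inv c := by simp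
  right_inv c := by simp

/-- The propagation operator `σ`. -/
def propagation (k₀ : (z : N) → K z) :
    ConfigSpace (Fin n → ℤ) k₀ ≃ₗᵢ[ℂ] ConfigSpace (Fin n → ℤ) k₀ :=
  permUnitary (propagate k₀)

end Propagation

end QCA

end

/-!
From automata to lattice gases, the proof is a GNS construction. Write `ω = |q₀⟩`, let `vac` be the
all-quiescent configuration, and let `𝒟_y` be the algebra of those operators `A` on a cell that `R`
moves by `-y`: for some `B`, the operator `A` on the cell `x` becomes `B` on the cell `x - y`
(`Intertwines`). By unitarity and translation invariance this describes `𝒟_{x-y,x}` for all `x` at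
once.

* `R` multiplies `vac` by a phase: `R vac` is square summable and translation invariant, and every
  other configuration has an infinite orbit (`eq_smul_vac_of_invariant`).
* The vacuum state factorizes over the algebras `𝒟_y`, although they all act on one cell:
  conjugation by `R` fixes this state and moves the factors to distinct cells, where `vac` is a
  product (`inner_list_prod_of_intertwines`). Algebras `𝒟_y` with distinct `y` commute
  because `R` moves them to distinct cells.
* Hence, with `V_y = 𝒟_y ω`, the map `⨂_y A_y ω ↦ ∏_y A_y ω` is an isometry from `⨂_y V_y` to the
  cell `W`, and by the local condition it is onto (`ComponentFrame.orthonormal_vecs`,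
  `ComponentFrame.span_cellVec`). It sends the simple tensor `⨂_y ω` to `ω`; its inverse is `S`.
* Operators in `𝒟_y` act on the factor `V_y` only. Conversely, an operator on the factor `V_y` is a
  combination of products `∏_z A_z` with `A_z ∈ 𝒟_z`, and taking the vacuum expectation over the
  factors `z ≠ y` turns each product into a multiple of `A_y ∈ 𝒟_y` without changing an operator on
  `V_y` (`ComponentFrame.exists_slice`, `ComponentFrame.localPiece_eq`).
* If `R` carries `A_y` to `B_y`, then `∏_y A_y ω ↦ ∏_y B_y ω` is, again by factorization, a unitary
  of `W`; this is the collision `F`. That `R` is propagation followed by collision is proved by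
  creating the particles of a configuration from the vacuum one at a time
  (`ComponentFrame.apply_prodVec`).

For the converse, the local condition holds because matrix units of a tensor product are products
of matrix units of its factors (`mem_span_list_prod_onComponent`). For causality, the same fact
shows that `R† A R`, with `A` on the cell `x`, acts on the neighborhood of `x` only. A density
operator is `B† B` with `B` Hilbert–Schmidt, and since the trace `tr (B† C)` does not depend on the
orthonormal basis (`tsum_inner_unitary`), the matrix entries of the restriction of `R ρ R†` to `x`
are expectation values of operators on the neighborhood, which depend on the restriction of `ρ`
only (`tsum_inner_of_actsOn`, `isCausal_of_actsOn`).
-/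

noncomputable section

namespace QCA

/-! ### Operators determined on basis vectors, and product vectors -/

section Basics

/-- A bounded linear map on `ℓ²` is determined by its values on the basis vectors. -/
theorem clm_ext_l2ket {ι E : Type*} [NormedAddCommGroup E] [NormedSpace ℂ E]
    {T T' : lp (fun _ : ι => ℂ) 2 →L[ℂ] E} (h : ∀ i, T (l2ket i) = T' (l2ket i)) : T = T' := by
  ext f
  have h1 := (hasSum_l2ket f).mapL T
  have h2 := (hasSum_l2ket f).mapL T'
  simp only [map_smul, h] at h1 h2
  exact h1.unique h2

theorem permUnitary_apply {ι κ : Type*} (e : ι ≃ κ) (f : lp (fun _ : ι => ℂ) 2) (i : ι) :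
    permUnitary e f (e i) = f i := by
  rw [← inner_l2ket_left, ← permUnitary_ket, LinearIsometryEquiv.inner_map_map, inner_l2ket_left]

theorem op_ext_ket {L Q : Type*} {q₀ : Q} {T T' : Op L q₀}
    (h : ∀ c, T (ket c) = T' (ket c)) : T = T' :=
  clm_ext_l2ket h

variable {L Q Q' : Type*} {q₀ : Q} {q₀' : Q'} [Fintype Q] [Fintype Q']

theorem finite_siteKet_ne (c : Config L q₀) :
    {x | siteKet (c.1 x) ≠ siteKet q₀}.Finite :=
  c.2.subset fun x hx h => hx (by simp only [h])

theorem ket_eq_prodVec (c : Config L q₀) :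
    ket c = prodVec (fun x => siteKet (c.1 x)) (finite_siteKet_ne c) := by
  classical
  apply lp.ext
  funext c'
  change l2ket c c' = prodCoord _ c'.1
  have hA : ∀ x, x ∉ c.2.toFinset ∪ c'.2.toFinset → c.1 x = q₀ ∧ c'.1 x = q₀ := by
    intro x hx
    simpa using hx
  rw [prodCoord_eq_prod (q₀ := q₀) _ (c.2.toFinset ∪ c'.2.toFinset)
    (fun x hx => by rw [(hA x hx).1]) _ (fun x hx => (hA x hx).2), l2ket_apply]
  simp only [siteKet_apply]
  rw [Finset.prod_ite_zero]
  simp only [Finset.prod_const_one]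
  by_cases hc : c' = c
  · rw [if_pos hc, if_pos fun x _ => by rw [hc]]
  · rw [if_neg hc, if_neg fun h => hc (Subtype.ext (funext fun x => ?_))]
    by_cases hx : x ∈ c.2.toFinset ∪ c'.2.toFinset
    · exact h x hx
    · rw [(hA x hx).1, (hA x hx).2]

theorem prodVec_congr {ψ φ : L → EuclideanSpace ℂ Q} (h : ψ = φ)
    (hψ : {x | ψ x ≠ siteKet q₀}.Finite) (hφ : {x | φ x ≠ siteKet q₀}.Finite) :
    prodVec ψ hψ = prodVec φ hφ := by
  subst h
  rfl

theorem cellwise_symm (U : EuclideanSpace ℂ Q ≃ₗᵢ[ℂ] EuclideanSpace ℂ Q')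
    (hU : U (siteKet q₀) = siteKet q₀') (hU' : U.symm (siteKet q₀') = siteKet q₀) :
    (cellwise L U hU).symm = cellwise L U.symm hU' := rfl

theorem finite_map_ne (U : EuclideanSpace ℂ Q ≃ₗᵢ[ℂ] EuclideanSpace ℂ Q')
    (hU : U (siteKet q₀) = siteKet q₀') {ψ : L → EuclideanSpace ℂ Q}
    (hψ : {x | ψ x ≠ siteKet q₀}.Finite) : {x | U (ψ x) ≠ siteKet q₀'}.Finite :=
  hψ.subset fun x hx h => hx (by rw [h, hU])

theorem cellwise_prodVec (U : EuclideanSpace ℂ Q ≃ₗᵢ[ℂ] EuclideanSpace ℂ Q')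
    (hU : U (siteKet q₀) = siteKet q₀') (ψ : L → EuclideanSpace ℂ Q)
    (hψ : {x | ψ x ≠ siteKet q₀}.Finite) :
    cellwise L U hU (prodVec ψ hψ) = prodVec (fun x => U (ψ x)) (finite_map_ne U hU hψ) := by
  classical
  have hU' : U.symm (siteKet q₀') = siteKet q₀ := by rw [← hU, U.symm_apply_apply]
  apply lp.ext
  funext c
  rw [← inner_l2ket_left, ← inner_l2ket_left, ← LinearIsometryEquiv.inner_map_map
    (cellwise L U hU).symm, LinearIsometryEquiv.symm_apply_apply, cellwise_symm U hU hU',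
    cellwise_ket, show l2ket c = _ from ket_eq_prodVec c]
  have hA : ∀ x, x ∉ c.2.toFinset ∪ hψ.toFinset → c.1 x = q₀' ∧ ψ x = siteKet q₀ := by
    intro x hx
    simpa using hx
  rw [inner_prodVec _ _ _ _ (c.2.toFinset ∪ hψ.toFinset)
      (fun x hx => by rw [(hA x hx).1, hU']) (fun x hx => (hA x hx).2),
    inner_prodVec _ _ _ _ (c.2.toFinset ∪ hψ.toFinset)
      (fun x hx => by rw [(hA x hx).1]) (fun x hx => by rw [(hA x hx).2, hU])]
  refine Finset.prod_congr rfl fun x _ => ?_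
  rw [← U.inner_map_map, U.apply_symm_apply]

end Basics

/-! ### The algebra of operators on one cell -/

section CellOps

variable {L Q : Type*} [DecidableEq L] {q₀ : Q} [Fintype Q]

local notation "W" => EuclideanSpace ℂ Q

theorem cellOp_apply (x : L) (A : W →ₗ[ℂ] W) (f : ConfigSpace L q₀) (c : Config L q₀) :
    cellOp x A f c = ∑ q : Q, A (siteKet q) (c.1 x) * f (setAt c x q) := by
  classical
  have h : (innerSL ℂ (ket c)).comp (cellOp x A) =
      ∑ q : Q, A (siteKet q) (c.1 x) • innerSL ℂ (ket (setAt c x q)) := by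
    refine clm_ext_l2ket fun c' => ?_
    simp only [ContinuousLinearMap.comp_apply, innerSL_apply_apply, sum_apply,
      smul_apply, inner_l2ket_left, smul_eq_mul, cellOp_ket, l2ket_apply,
      inner_sum, inner_smul_right, mul_ite, mul_one, mul_zero]
    by_cases hc : ∀ y, y ≠ x → c.1 y = c'.1 y
    · have h1 : ∀ r, c = setAt c' x r ↔ r = c.1 x := fun r => by
        refine ⟨fun h => by simp [h, setAt], fun h => Subtype.ext (funext fun y => ?_)⟩
        by_cases hy : y = x
        · subst hy; simp [setAt, h]
        · simp [setAt, hy, hc y hy]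
      have h2 : ∀ r, setAt c x r = c' ↔ r = c'.1 x := fun r => by
        refine ⟨fun h => by simp [← h, setAt], fun h => Subtype.ext (funext fun y => ?_)⟩
        by_cases hy : y = x
        · subst hy; simp [setAt, h]
        · simp [setAt, hy, hc y hy]
      simp [h1, h2]
    · push Not at hc
      obtain ⟨y, hy, hne⟩ := hc
      rw [Finset.sum_eq_zero, Finset.sum_eq_zero]
      · intro r _
        refine if_neg fun h => hne ?_
        simp [← h, setAt, hy]
      · intro r _
        refine if_neg fun h => hne ?_
        simp [h, setAt, hy]
  have := congrArg (fun T => T f) h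
  simpa [inner_l2ket_left] using this

theorem finite_update_ne {ψ : L → W} (hψ : {x | ψ x ≠ siteKet q₀}.Finite) (x : L) (v : W) :
    {y | Function.update ψ x v y ≠ siteKet q₀}.Finite :=
  (hψ.insert x).subset fun y hy => by
    by_cases h : y = x
    · exact Or.inl h
    · exact Or.inr (by simpa [Function.update_of_ne h] using hy)

theorem cellOp_prodVec (x : L) (A : W →ₗ[ℂ] W) (ψ : L → W)
    (hψ : {x | ψ x ≠ siteKet q₀}.Finite) :
    cellOp x A (prodVec ψ hψ) =
      prodVec (Function.update ψ x (A (ψ x))) (finite_update_ne hψ x _) := by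
  classical
  apply lp.ext
  funext c
  rw [cellOp_apply]
  have hA : ∀ y, y ∉ insert x (c.2.toFinset ∪ hψ.toFinset) →
      y ≠ x ∧ c.1 y = q₀ ∧ ψ y = siteKet q₀ := by
    intro y hy
    simpa using hy
  set s := insert x (c.2.toFinset ∪ hψ.toFinset) with hs
  have hx : x ∈ s := Finset.mem_insert_self _ _
  change ∑ q, _ * prodCoord ψ (setAt c x q).1 = prodCoord _ c.1
  rw [prodCoord_eq_prod (q₀ := q₀) _ s (fun y hy => by
    rw [Function.update_of_ne (hA y hy).1, (hA y hy).2.2]) c (fun y hy => (hA y hy).2.1),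
    ← Finset.mul_prod_erase s _ hx, Function.update_self]
  have h1 : ∀ q, prodCoord ψ (setAt c x q).1 = ψ x q * ∏ y ∈ s.erase x, ψ y (c.1 y) := fun q => by
    rw [prodCoord_eq_prod (q₀ := q₀) ψ s (fun y hy => (hA y hy).2.2) (setAt c x q) (fun y hy => by
      simp [setAt, (hA y hy).1, (hA y hy).2.1]), ← Finset.mul_prod_erase s _ hx]
    congr 1
    · simp [setAt]
    · refine Finset.prod_congr rfl fun y hy => ?_
      simp [setAt, Finset.ne_of_mem_erase hy]
  have h2 : A (ψ x) (c.1 x) = ∑ q, A (siteKet q) (c.1 x) * ψ x q := by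
    have h3 : ψ x = ∑ q, ψ x q • siteKet q := by
      ext r
      simp [siteKet_apply]
    conv_lhs => rw [h3]
    simp [mul_comm]
  simp only [h1]
  have h3 : ∏ y ∈ s.erase x, Function.update ψ x (A (ψ x)) y (c.1 y) =
      ∏ y ∈ s.erase x, ψ y (c.1 y) := by
    refine Finset.prod_congr rfl fun y hy => ?_
    rw [Function.update_of_ne (Finset.ne_of_mem_erase hy)]
  rw [h2, h3, Finset.sum_mul]
  exact Finset.sum_congr rfl fun q _ => (mul_assoc _ _ _).symm

theorem cellOp_add (x : L) (A B : W →ₗ[ℂ] W) :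
    (cellOp x (A + B) : Op L q₀) = cellOp x A + cellOp x B := by
  simp [cellOp, add_smul, Finset.sum_add_distrib]

theorem cellOp_smul (x : L) (a : ℂ) (A : W →ₗ[ℂ] W) :
    (cellOp x (a • A) : Op L q₀) = a • cellOp x A := by
  simp [cellOp, Finset.smul_sum, smul_smul]

theorem cellOp_mul (x : L) (A B : W →ₗ[ℂ] W) :
    (cellOp x (A * B) : Op L q₀) = cellOp x A * cellOp x B := by
  refine op_ext_ket fun c => ?_
  rw [mul_apply_eq_comp, ket_eq_prodVec, cellOp_prodVec, cellOp_prodVec,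
    cellOp_prodVec]
  exact prodVec_congr (by simp) _ _

theorem cellOp_one (x : L) : (cellOp x (1 : W →ₗ[ℂ] W) : Op L q₀) = 1 := by
  refine clm_ext_l2ket fun c => ?_
  change cellOp x 1 (ket c) = ket c
  rw [ket_eq_prodVec, cellOp_prodVec]
  exact prodVec_congr (by simp) _ _

/-- The embedding of `End(W)` as the algebra of operators on the cell `x`, as a homomorphism of
algebras. -/
def cellHom (q₀ : Q) (x : L) : Module.End ℂ W →ₐ[ℂ] Op L q₀ :=
  AlgHom.ofLinearMap
    { toFun := cellOp x
      map_add' := cellOp_add x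
      map_smul' := cellOp_smul x }
    (cellOp_one x) (cellOp_mul x)

theorem cellHom_apply (x : L) (A : Module.End ℂ W) : cellHom q₀ x A = cellOp x A := rfl

theorem cellOp_injective (x : L) :
    Function.Injective (cellOp x : (W →ₗ[ℂ] W) → Op L q₀) := by
  classical
  intro A B h
  refine (EuclideanSpace.basisFun Q ℂ).toBasis.ext fun q => ?_
  ext r
  have key : ∀ A : W →ₗ[ℂ] W, (cellOp x A : Op L q₀) (ket (setAt (vac L q₀) x q))
      (setAt (vac L q₀) x r) = A (siteKet q) r := fun A => by
    rw [cellOp_apply, Finset.sum_eq_single q]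
    · simp [setAt, l2ket_apply]
    · intro q' _ hq'
      have h1 : setAt (setAt (vac L q₀) x r) x q' ≠ setAt (vac L q₀) x q := fun h => hq' (by
        have := congrFun (congrArg Subtype.val h) x
        simpa [setAt] using this)
      simp [l2ket_apply, h1]
    · simp
  have h1 := key A
  rw [h, key B] at h1
  have h2 : (EuclideanSpace.basisFun Q ℂ).toBasis q = siteKet q := by
    simp [siteKet]
  rw [h2]
  exact h1.symm

theorem cellOp_commute {x y : L} (hxy : x ≠ y) (A B : W →ₗ[ℂ] W) :
    Commute (cellOp x A : Op L q₀) (cellOp y B) := by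
  refine op_ext_ket fun c => ?_
  rw [mul_apply_eq_comp, mul_apply_eq_comp, ket_eq_prodVec,
    cellOp_prodVec, cellOp_prodVec, cellOp_prodVec, cellOp_prodVec]
  refine prodVec_congr ?_ _ _
  rw [Function.update_of_ne hxy, Function.update_of_ne hxy.symm, Function.update_comm hxy]

theorem cellwise_cellOp {Q' : Type*} [Fintype Q'] {q₀' : Q'}
    (U : EuclideanSpace ℂ Q ≃ₗᵢ[ℂ] EuclideanSpace ℂ Q')
    (hU : U (siteKet q₀) = siteKet q₀') (x : L) (A : W →ₗ[ℂ] W)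
    (A' : EuclideanSpace ℂ Q' →ₗ[ℂ] EuclideanSpace ℂ Q') (h : ∀ v, U (A v) = A' (U v))
    (f : ConfigSpace L q₀) :
    cellwise L U hU (cellOp x A f) = cellOp x A' (cellwise L U hU f) := by
  have key : (cellwise L U hU).toContinuousLinearEquiv.toContinuousLinearMap.comp (cellOp x A) =
      (cellOp x A').comp (cellwise L U hU).toContinuousLinearEquiv.toContinuousLinearMap := by
    refine clm_ext_l2ket fun c => ?_
    change cellwise L U hU (cellOp x A (ket c)) = cellOp x A' (cellwise L U hU (ket c))
    rw [ket_eq_prodVec, cellOp_prodVec, cellwise_prodVec, cellwise_prodVec, cellOp_prodVec]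
    refine prodVec_congr (funext fun y => ?_) _ _
    by_cases hy : y = x
    · subst hy; simp [h]
    · simp [hy]
  exact congrArg (fun T => T f) key

end CellOps

/-! ### Translations -/

section Translations

variable {n : ℕ} {Q : Type*} {q₀ : Q}

theorem translation_apply (z : Fin n → ℤ) (f : ConfigSpace (Fin n → ℤ) q₀)
    (c : Config (Fin n → ℤ) q₀) : translation q₀ z f (shift q₀ z c) = f c :=
  permUnitary_apply _ _ _

theorem translation_ket (z : Fin n → ℤ) (c : Config (Fin n → ℤ) q₀) :
    translation q₀ z (ket c) = ket (shift q₀ z c) :=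
  permUnitary_ket _ _

theorem translation_comm {M : Op (Fin n → ℤ) q₀} (hM : IsTranslationInvariant M)
    (z : Fin n → ℤ) (f : ConfigSpace (Fin n → ℤ) q₀) :
    translation q₀ z (M f) = M (translation q₀ z f) := by
  have := hM z (translation q₀ z f)
  rwa [LinearIsometryEquiv.symm_apply_apply] at this

theorem translation_prodVec [Fintype Q] (z : Fin n → ℤ) (ψ : (Fin n → ℤ) → EuclideanSpace ℂ Q)
    (hψ : {x | ψ x ≠ siteKet q₀}.Finite) (hψ' : {x | ψ (x + z) ≠ siteKet q₀}.Finite) :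
    translation q₀ z (prodVec ψ hψ) = prodVec (fun x => ψ (x + z)) hψ' := by
  apply lp.ext
  funext c
  obtain ⟨c, rfl⟩ := (shift q₀ z).surjective c
  rw [translation_apply]
  change ∏ᶠ x, ψ x (c.1 x) = ∏ᶠ x, ψ (x + z) (c.1 (x + z))
  exact (finprod_comp_equiv (Equiv.addRight z) (f := fun x => ψ x (c.1 x))).symm

theorem translation_cellOp [Fintype Q] (z x : Fin n → ℤ)
    (A : EuclideanSpace ℂ Q →ₗ[ℂ] EuclideanSpace ℂ Q) (f : ConfigSpace (Fin n → ℤ) q₀) :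
    translation q₀ z (cellOp x A f) = cellOp (x - z) A (translation q₀ z f) := by
  have key : (translation q₀ z).toContinuousLinearEquiv.toContinuousLinearMap.comp (cellOp x A) =
      (cellOp (x - z) A).comp
        (translation q₀ z).toContinuousLinearEquiv.toContinuousLinearMap := by
    refine clm_ext_l2ket fun c => ?_
    change translation q₀ z (cellOp x A (ket c)) = cellOp (x - z) A (translation q₀ z (ket c))
    simp only [cellOp_ket, map_sum, map_smul, translation_ket]
    refine Finset.sum_congr (by simp) fun r _ => ?_
    congr 2
    · simp [shift]
    · refine Subtype.ext (funext fun y => ?_)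
      by_cases hy : y = x - z
      · subst hy; simp [shift, setAt]
      · have : y + z ≠ x := fun h => hy (by rw [← h, add_sub_cancel_right])
        simp [shift, setAt, hy, this]
  exact congrArg (fun T => T f) key

/-- A translation invariant vector is a multiple of the vacuum: its coefficients are constant
along translation orbits, and the orbit of any other configuration is infinite. -/
theorem eq_smul_vac_of_invariant (hn : 0 < n) (f : ConfigSpace (Fin n → ℤ) q₀)
    (hf : ∀ z, translation q₀ z f = f) :
    f = f (vac (Fin n → ℤ) q₀) • ket (vac (Fin n → ℤ) q₀) := by
  classical
  have hzero : ∀ c : Config (Fin n → ℤ) q₀, c ≠ vac (Fin n → ℤ) q₀ → f c = 0 := by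
    intro c hc
    by_contra hfc
    obtain ⟨x₀, hx₀⟩ : ∃ x, c.1 x ≠ q₀ := by
      by_contra h
      push Not at h
      exact hc (Subtype.ext (funext h))
    have hconst : ∀ z, f (shift q₀ z c) = f c := fun z => by
      conv_lhs => rw [← hf z]
      exact translation_apply _ _ _
    have hsum : Summable fun c => ‖f c‖ ^ (2 : ℝ) := by
      have := (lp.memℓp f).summable (by simp)
      simpa using this
    have hfin : {c' : Config (Fin n → ℤ) q₀ | ‖f c‖ ^ (2 : ℝ) ≤ ‖f c'‖ ^ (2 : ℝ)}.Finite := by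
      have hpos : 0 < ‖f c‖ ^ (2 : ℝ) := Real.rpow_pos_of_pos (norm_pos_iff.2 hfc) _
      have := (hsum.tendsto_cofinite_zero.eventually (gt_mem_nhds hpos))
      rw [Filter.eventually_cofinite] at this
      simpa using this
    have hunion := hfin.biUnion (t := fun c' => {x | c'.1 x ≠ q₀}) fun c' _ => c'.2
    have hinj : Function.Injective fun k : ℕ => x₀ - Pi.single (⟨0, hn⟩ : Fin n) (k : ℤ) := by
      intro k k' h
      have := congrFun h ⟨0, hn⟩
      simpa using this
    refine Set.infinite_range_of_injective hinj (hunion.subset ?_)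
    rintro _ ⟨k, rfl⟩
    refine Set.mem_biUnion (x := shift q₀ (Pi.single (⟨0, hn⟩ : Fin n) (k : ℤ)) c) ?_ ?_
    · simp [hconst]
    · simpa [shift] using hx₀
  apply lp.ext
  funext c
  by_cases hc : c = vac (Fin n → ℤ) q₀
  · subst hc; simp [l2ket_apply]
  · simp [l2ket_apply, hc, hzero c hc]

end Translations

/-! ### Operators on one tensor component -/

section ComponentLemmas

variable {ι : Type*} [Fintype ι] [DecidableEq ι] (d : ι → ℕ)

theorem basisFun_eq_siteKet {Q : Type*} [Fintype Q] (q : Q) :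
    (EuclideanSpace.basisFun Q ℂ).toBasis q = siteKet q := by
  classical
  simp [siteKet]

theorem eq_sum_siteKet {Q : Type*} [Fintype Q] (v : EuclideanSpace ℂ Q) :
    v = ∑ q, v q • siteKet q := by
  classical
  ext r
  simp [siteKet_apply]

theorem linearMap_ext_siteKet {Q E : Type*} [Fintype Q] [AddCommGroup E] [Module ℂ E]
    {A B : EuclideanSpace ℂ Q →ₗ[ℂ] E} (h : ∀ q, A (siteKet q) = B (siteKet q)) : A = B :=
  (EuclideanSpace.basisFun Q ℂ).toBasis.ext fun q => by rw [basisFun_eq_siteKet, h]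

/-- The linear map `ℂ[Q] → E` with `|q⟩ ↦ v q`. -/
def ofColumns {Q E : Type*} [Fintype Q] [AddCommGroup E] [Module ℂ E] (v : Q → E) :
    EuclideanSpace ℂ Q →ₗ[ℂ] E :=
  (EuclideanSpace.basisFun Q ℂ).toBasis.constr ℂ v

theorem ofColumns_siteKet {Q E : Type*} [Fintype Q] [AddCommGroup E] [Module ℂ E] (v : Q → E)
    (q : Q) : ofColumns v (siteKet q) = v q := by
  rw [← basisFun_eq_siteKet, ofColumns, Module.Basis.constr_basis]

theorem onComponent_siteKet (y : ι) (e : Component d y →ₗ[ℂ] Component d y) (m : Label d) :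
    onComponent d y e (siteKet m) =
      ∑ i, e (siteKet (m y)) i • siteKet (Function.update m y i) := by
  rw [← tensorCoord_siteKet, onComponent_tprod]
  conv_lhs => rw [eq_sum_siteKet (e (siteKet (m y)))]
  rw [MultilinearMap.map_update_sum, map_sum]
  refine Finset.sum_congr rfl fun i _ => ?_
  rw [MultilinearMap.map_update_smul, map_smul, ← tensorCoord_siteKet]
  congr 3
  funext z
  by_cases hz : z = y
  · subst hz; simp
  · simp [hz]

end ComponentLemmas

/-! ### Products along a list of commuting families -/

section ListProducts

variable {ι M : Type*} [DecidableEq ι] [Monoid M]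

/-- A factor of a product of commuting elements can be moved to the front. -/
theorem list_prod_eq_mul_update {l : List ι} (hl : l.Nodup) {g : ι → M}
    (hg : ∀ i j, i ≠ j → Commute (g i) (g j)) {y : ι} (hy : y ∈ l) :
    (l.map g).prod = g y * (l.map (Function.update g y 1)).prod := by
  induction l with
  | nil => simp at hy
  | cons z l ih =>
    rw [List.nodup_cons] at hl
    by_cases hz : z = y
    · subst hz
      have : l.map (Function.update g z 1) = l.map g := List.map_congr_left fun w hw => by
        have hwz : w ≠ z := by
          rintro rfl
          exact hl.1 hw
        rw [Function.update_of_ne hwz]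
      simp [this]
    · have hy' : y ∈ l := by simpa [Ne.symm hz] using hy
      rw [List.map_cons, List.prod_cons, ih hl.2 hy', List.map_cons, List.prod_cons,
        Function.update_of_ne hz, ← mul_assoc, ← mul_assoc, (hg z y hz).eq]

end ListProducts

/-- The elements of the neighborhood, listed. -/
def nbhdList {α : Type*} (N : Finset α) : List N :=
  N.toList.attachWith (· ∈ N) fun _ h => Finset.mem_toList.1 h

theorem nbhdList_map_val {α : Type*} (N : Finset α) :
    (nbhdList N).map Subtype.val = N.toList :=
  List.attachWith_map_subtype_val _

theorem nodup_nbhdList {α : Type*} (N : Finset α) : (nbhdList N).Nodup :=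
  List.Nodup.of_map Subtype.val (by rw [nbhdList_map_val]; exact N.nodup_toList)

theorem mem_nbhdList {α : Type*} {N : Finset α} (y : N) : y ∈ nbhdList N := by
  have : y.1 ∈ (nbhdList N).map Subtype.val := by rw [nbhdList_map_val]; simp
  obtain ⟨z, hz, h⟩ := List.mem_map.1 this
  rwa [← Subtype.ext h]

/-! ### Products of cell operators applied to the vacuum -/

section VacuumProducts

variable {L Q : Type*} [DecidableEq L] {q₀ : Q} [Fintype Q]

local notation "W" => EuclideanSpace ℂ Q

/-- Operators on distinct cells `p y`, applied to the vacuum, create the product vector with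
`B y |q₀⟩` in the cell `p y` and `|q₀⟩` in all other cells. -/
theorem exists_prodVec_of_list {ι : Type*} {p : ι → L} (hp : Function.Injective p)
    (B : ι → Module.End ℂ W) {l : List ι} (hl : l.Nodup) :
    ∃ (ψ : L → W) (hψ : {x | ψ x ≠ siteKet q₀}.Finite),
      (l.map fun y => (cellOp (p y) (B y) : Op L q₀)).prod (ket (vac L q₀)) = prodVec ψ hψ ∧
      (∀ y ∈ l, ψ (p y) = B y (siteKet q₀)) ∧ ∀ z, z ∉ l.map p → ψ z = siteKet q₀ := by
  induction l with
  | nil => exact ⟨_, _, ket_eq_prodVec (vac L q₀), by simp, fun z _ => rfl⟩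
  | cons y l ih =>
    rw [List.nodup_cons] at hl
    obtain ⟨ψ, hψ, h1, h2, h3⟩ := ih hl.2
    have hy : ψ (p y) = siteKet q₀ := h3 _ (by simpa [hp.eq_iff] using hl.1)
    refine ⟨_, finite_update_ne hψ (p y) (B y (ψ (p y))), ?_, ?_, ?_⟩
    · rw [List.map_cons, List.prod_cons, mul_apply_eq_comp, h1, cellOp_prodVec]
    · intro z hz
      by_cases hzy : z = y
      · subst hzy; simp [hy]
      · rw [Function.update_of_ne (hp.ne hzy), h2 z (by simpa [hzy] using hz)]
    · intro z hz
      rw [List.map_cons, List.mem_cons, not_or] at hz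
      rw [Function.update_of_ne hz.1, h3 z hz.2]

/-- The vacuum is a product state: inner products of vectors created from it by operators on
distinct cells factorize. -/
theorem inner_list_prod_vac {ι : Type*} {p : ι → L} (hp : Function.Injective p)
    (B B' : ι → Module.End ℂ W) {l : List ι} (hl : l.Nodup) :
    ⟪(l.map fun y => (cellOp (p y) (B y) : Op L q₀)).prod (ket (vac L q₀)),
      (l.map fun y => (cellOp (p y) (B' y) : Op L q₀)).prod (ket (vac L q₀))⟫_ℂ =
      (l.map fun y => ⟪B y (siteKet q₀), B' y (siteKet q₀)⟫_ℂ).prod := by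
  obtain ⟨ψ, hψ, h1, h2, h3⟩ := exists_prodVec_of_list (q₀ := q₀) hp B hl
  obtain ⟨φ, hφ, h1', h2', h3'⟩ := exists_prodVec_of_list (q₀ := q₀) hp B' hl
  rw [h1, h1', inner_prodVec _ _ _ _ (l.map p).toFinset (fun x hx => h3 x (by simpa using hx))
    (fun x hx => h3' x (by simpa using hx)), List.prod_toFinset _ (hl.map hp), List.map_map]
  refine congrArg List.prod (List.map_congr_left fun y hy => ?_)
  simp [h2 y hy, h2' y hy]

theorem inner_cellOp_vac (x : L) (B B' : Module.End ℂ W) :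
    ⟪(cellOp x B : Op L q₀) (ket (vac L q₀)), (cellOp x B' : Op L q₀) (ket (vac L q₀))⟫_ℂ =
      ⟪B (siteKet q₀), B' (siteKet q₀)⟫_ℂ := by
  simpa using inner_list_prod_vac (q₀ := q₀) (ι := Unit) (p := fun _ => x)
    (fun _ _ _ => rfl) (fun _ => B) (fun _ => B') (l := [()]) (by simp)

theorem cellOp_list_prod {ι : Type*} (x : L) (A : ι → Module.End ℂ W) (l : List ι) :
    (cellOp x (l.map A).prod : Op L q₀) = (l.map fun y => cellOp x (A y)).prod := by
  rw [← cellHom_apply, map_list_prod, List.map_map]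
  rfl

end VacuumProducts

/-! ### Operators moved from one cell to another -/

section Unitary

variable {n : ℕ} {Q : Type*} {q₀ : Q} {R : Op (Fin n → ℤ) q₀}

theorem mul_left_cancel_of_unitary (hU : R ∈ unitary (Op (Fin n → ℤ) q₀))
    {T T' : Op (Fin n → ℤ) q₀} (h : R * T = R * T') : T = T' := by
  have := congrArg (star R * ·) h
  simpa only [← mul_assoc, Unitary.star_mul_self_of_mem hU, one_mul] using this

theorem mul_right_cancel_of_unitary (hU : R ∈ unitary (Op (Fin n → ℤ) q₀))
    {T T' : Op (Fin n → ℤ) q₀} (h : T * R = T' * R) : T = T' := by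
  have := congrArg (· * star R) h
  simpa only [mul_assoc, Unitary.mul_star_self_of_mem hU, mul_one] using this

theorem inner_map_of_unitary (hU : R ∈ unitary (Op (Fin n → ℤ) q₀))
    (f g : ConfigSpace (Fin n → ℤ) q₀) : ⟪R f, R g⟫_ℂ = ⟪f, g⟫_ℂ := by
  rw [← ContinuousLinearMap.adjoint_inner_right, ← ContinuousLinearMap.comp_apply]
  have := Unitary.star_mul_self_of_mem hU
  rw [ContinuousLinearMap.star_eq_adjoint] at this
  rw [← ContinuousLinearMap.mul_def, this]
  rfl

end Unitary

section Intertwining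

variable {n : ℕ} {Q : Type*} {q₀ : Q} [Fintype Q]

local notation "W" => EuclideanSpace ℂ Q

/-- `R` carries the operator `A` on any cell `x` to the operator `B` on the cell `x - y`. For
unitary, translation invariant `R`, such a `B` exists if and only if `A` on the cell `x` belongs to
`𝒟_{x-y,x}`. -/
def Intertwines (R : Op (Fin n → ℤ) q₀) (y : Fin n → ℤ) (A B : Module.End ℂ W) : Prop :=
  ∀ x, R * cellOp x A = cellOp (x - y) B * R

variable {R : Op (Fin n → ℤ) q₀} {y : Fin n → ℤ}

theorem Intertwines.one : Intertwines R y (1 : Module.End ℂ W) 1 := fun x => by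
  rw [cellOp_one, cellOp_one, mul_one, one_mul]

theorem Intertwines.zero : Intertwines R y (0 : Module.End ℂ W) 0 := fun x => by
  rw [← cellHom_apply, ← cellHom_apply, map_zero, map_zero, mul_zero, zero_mul]

theorem Intertwines.add {A B A' B' : Module.End ℂ W} (h : Intertwines R y A B)
    (h' : Intertwines R y A' B') : Intertwines R y (A + A') (B + B') := fun x => by
  rw [cellOp_add, cellOp_add, mul_add, add_mul, h x, h' x]

theorem Intertwines.smul {A B : Module.End ℂ W} (h : Intertwines R y A B) (a : ℂ) :
    Intertwines R y (a • A) (a • B) := fun x => by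
  rw [cellOp_smul, cellOp_smul, mul_smul_comm, smul_mul_assoc, h x]

theorem Intertwines.mul {A B A' B' : Module.End ℂ W} (h : Intertwines R y A B)
    (h' : Intertwines R y A' B') : Intertwines R y (A * A') (B * B') := fun x => by
  rw [cellOp_mul, cellOp_mul, ← mul_assoc, h x, mul_assoc, h' x, mul_assoc]

/-- Operators that `R` moves from one cell to distinct cells commute, because their images do. -/
theorem Intertwines.commute_left (hU : R ∈ unitary (Op (Fin n → ℤ) q₀)) {y' : Fin n → ℤ}
    (hy : y ≠ y') {A B A' B' : Module.End ℂ W} (h : Intertwines R y A B)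
    (h' : Intertwines R y' A' B') : Commute A A' := by
  refine cellOp_injective (q₀ := q₀) (0 : Fin n → ℤ) ?_
  rw [cellOp_mul, cellOp_mul]
  refine mul_left_cancel_of_unitary hU ?_
  have hne : (0 : Fin n → ℤ) - y ≠ 0 - y' := fun e => hy (by simpa using e)
  rw [← mul_assoc, h, mul_assoc, h', ← mul_assoc, (cellOp_commute hne B B').eq, mul_assoc, ← h,
    ← mul_assoc, ← h', mul_assoc]

/-- Operators that `R` moves to one cell from distinct cells commute, because their preimages
do. -/
theorem Intertwines.commute_right (hU : R ∈ unitary (Op (Fin n → ℤ) q₀)) {y' : Fin n → ℤ}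
    (hy : y ≠ y') {A B A' B' : Module.End ℂ W} (h : Intertwines R y A B)
    (h' : Intertwines R y' A' B') : Commute B B' := by
  refine cellOp_injective (q₀ := q₀) (0 : Fin n → ℤ) ?_
  rw [cellOp_mul, cellOp_mul]
  refine mul_right_cancel_of_unitary hU ?_
  have e := h y
  have e' := h' y'
  rw [sub_self] at e e'
  rw [mul_assoc, mul_assoc, ← e, ← e', ← mul_assoc, ← mul_assoc, ← e, ← e', mul_assoc, mul_assoc,
    (cellOp_commute hy A A').eq]

theorem mul_list_prod_of_intertwines {ι : Type*} {p : ι → Fin n → ℤ} (x : ι → Fin n → ℤ)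
    {A B : ι → Module.End ℂ W} (h : ∀ i, Intertwines R (p i) (A i) (B i)) (l : List ι) :
    R * (l.map fun i => cellOp (x i) (A i)).prod =
      (l.map fun i => cellOp (x i - p i) (B i)).prod * R := by
  induction l with
  | nil => simp
  | cons i l ih =>
    rw [List.map_cons, List.prod_cons, List.map_cons, List.prod_cons, ← mul_assoc, h i, mul_assoc,
      ih, mul_assoc]

/-- The vacuum state factorizes over the algebras `𝒟_{x-y,x}` with distinct `y`: these act on the
same cell `x`, but `R` spreads them over distinct cells and fixes the vacuum up to a phase. -/
theorem inner_list_prod_of_intertwines (hU : R ∈ unitary (Op (Fin n → ℤ) q₀)) {phase : ℂ}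
    (hphase : ‖phase‖ = 1)
    (hvac : R (ket (vac (Fin n → ℤ) q₀)) = phase • ket (vac (Fin n → ℤ) q₀))
    {ι : Type*} {p : ι → Fin n → ℤ} (hp : Function.Injective p)
    {A B A' B' : ι → Module.End ℂ W} (h : ∀ i, Intertwines R (p i) (A i) (B i))
    (h' : ∀ i, Intertwines R (p i) (A' i) (B' i)) {l : List ι} (hl : l.Nodup) :
    ⟪(l.map A).prod (siteKet q₀), (l.map A').prod (siteKet q₀)⟫_ℂ =
        (l.map fun i => ⟪B i (siteKet q₀), B' i (siteKet q₀)⟫_ℂ).prod ∧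
      ⟪(l.map B).prod (siteKet q₀), (l.map B').prod (siteKet q₀)⟫_ℂ =
        (l.map fun i => ⟪A i (siteKet q₀), A' i (siteKet q₀)⟫_ℂ).prod := by
  have hph : (starRingEnd ℂ) phase * phase = 1 := by
    rw [← Complex.normSq_eq_conj_mul_self, Complex.normSq_eq_norm_sq, hphase]
    simp
  have hsm : ∀ f g : ConfigSpace (Fin n → ℤ) q₀, ⟪phase • f, phase • g⟫_ℂ = ⟪f, g⟫_ℂ := by
    intro f g
    rw [inner_smul_left, inner_smul_right, ← mul_assoc, hph, one_mul]
  constructor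
  · have key : ∀ {A B : ι → Module.End ℂ W}, (∀ i, Intertwines R (p i) (A i) (B i)) →
        R (cellOp 0 (l.map A).prod (ket (vac (Fin n → ℤ) q₀))) =
          phase • (l.map fun i => (cellOp (0 - p i) (B i) : Op (Fin n → ℤ) q₀)).prod
            (ket (vac (Fin n → ℤ) q₀)) := by
      intro A B h
      have := congrArg (fun T => T (ket (vac (Fin n → ℤ) q₀)))
        (mul_list_prod_of_intertwines (fun _ => 0) h l)
      simp only [mul_apply_eq_comp, hvac, map_smul] at this
      rw [← this, cellOp_list_prod]
    rw [← inner_cellOp_vac (q₀ := q₀) (0 : Fin n → ℤ), ← inner_map_of_unitary hU, key h, key h',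
      hsm, inner_list_prod_vac (fun i j e => hp (by simpa using e)) _ _ hl]
  · have key : ∀ {A B : ι → Module.End ℂ W}, (∀ i, Intertwines R (p i) (A i) (B i)) →
        R ((l.map fun i => (cellOp (p i) (A i) : Op (Fin n → ℤ) q₀)).prod
            (ket (vac (Fin n → ℤ) q₀))) =
          phase • cellOp 0 (l.map B).prod (ket (vac (Fin n → ℤ) q₀)) := by
      intro A B h
      have := congrArg (fun T => T (ket (vac (Fin n → ℤ) q₀)))
        (mul_list_prod_of_intertwines p h l)
      simp only [mul_apply_eq_comp, hvac, map_smul, sub_self] at this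
      rw [this, cellOp_list_prod]
    rw [← inner_cellOp_vac (q₀ := q₀) (0 : Fin n → ℤ), ← hsm, ← key h, ← key h',
      inner_map_of_unitary hU, inner_list_prod_vac hp _ _ hl]

/-- `R` preserves the vacuum expectation of the operators that it moves. -/
theorem Intertwines.inner_eq (hU : R ∈ unitary (Op (Fin n → ℤ) q₀)) {phase : ℂ}
    (hphase : ‖phase‖ = 1)
    (hvac : R (ket (vac (Fin n → ℤ) q₀)) = phase • ket (vac (Fin n → ℤ) q₀))
    {A B A' B' : Module.End ℂ W} (h : Intertwines R y A B) (h' : Intertwines R y A' B') :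
    ⟪B (siteKet q₀), B' (siteKet q₀)⟫_ℂ = ⟪A (siteKet q₀), A' (siteKet q₀)⟫_ℂ := by
  simpa using (inner_list_prod_of_intertwines hU hphase hvac (ι := Unit) (p := fun _ => y)
    (fun _ _ _ => rfl) (A := fun _ => A) (A' := fun _ => A') (fun _ => h) (fun _ => h')
    (l := [()]) (by simp)).2

theorem mem_localPiece_of_intertwines (hU : R ∈ unitary (Op (Fin n → ℤ) q₀))
    {A B : Module.End ℂ W} (h : Intertwines R y A B) (x : Fin n → ℤ) :
    cellOp x A ∈ localPiece R (x - y) x := by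
  refine ⟨⟨_, ⟨B, rfl⟩, ?_⟩, ⟨A, rfl⟩⟩
  have := Unitary.star_mul_self_of_mem hU
  change _ = star R * (cellOp (x - y) B * R)
  rw [← h x, ← mul_assoc, this, one_mul]

/-- By translation invariance, a relation between the cells `x` and `x - y` for one `x` holds for
all `x`. -/
theorem exists_intertwines_of_mem_localPiece (hU : R ∈ unitary (Op (Fin n → ℤ) q₀))
    (hT : IsTranslationInvariant R) {x : Fin n → ℤ} {T : Op (Fin n → ℤ) q₀}
    (h : T ∈ localPiece R (x - y) x) :
    ∃ A B : Module.End ℂ W, T = cellOp x A ∧ Intertwines R y A B := by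
  obtain ⟨⟨_, ⟨B, rfl⟩, hB⟩, ⟨A, rfl⟩⟩ := h
  refine ⟨A, B, rfl, fun x' => ?_⟩
  have h0 : R * cellOp x A = cellOp (x - y) B * R := by
    rw [hB]
    change R * (star R * (cellOp (x - y) B * R)) = _
    rw [← mul_assoc, Unitary.mul_star_self_of_mem hU, one_mul]
  refine op_ext_ket fun c => ?_
  obtain ⟨f, hf⟩ := (translation q₀ (x - x')).surjective (ket c)
  rw [← hf]
  have h1 := congrArg (fun T => translation q₀ (x - x') (T f)) h0
  simp only [mul_apply_eq_comp, translation_comm hT, translation_cellOp] at h1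
  simp only [mul_apply_eq_comp]
  have e1 : x - (x - x') = x' := by abel
  have e2 : x - y - (x - x') = x' - y := by abel
  rwa [e1, e2] at h1

end Intertwining

/-! ### The components of a cell -/

section Frames

variable {n : ℕ} {Q : Type*} {q₀ : Q} [Fintype Q]

local notation "W" => EuclideanSpace ℂ Q

theorem inner_siteKet_self {Q : Type*} [Fintype Q] (q : Q) : ⟪siteKet q, siteKet q⟫_ℂ = 1 := by
  classical
  rw [inner_siteKet_left, siteKet_apply, if_pos rfl]

/-- The submodule of operators `A` on a cell such that `A` on the cell `x` is carried by `R` to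
the cell `x - y`. -/
def movable (R : Op (Fin n → ℤ) q₀) (y : Fin n → ℤ) : Submodule ℂ (Module.End ℂ W) where
  carrier := {A | ∃ B, Intertwines R y A B}
  zero_mem' := ⟨0, Intertwines.zero⟩
  add_mem' := fun ⟨B, h⟩ ⟨B', h'⟩ => ⟨B + B', h.add h'⟩
  smul_mem' := fun a _ ⟨B, h⟩ => ⟨a • B, h.smul a⟩

/-- For every `y ∈ N`, an orthonormal basis of the space `V_y = 𝒟_y |q₀⟩`, where `𝒟_y` is the
algebra of operators on a cell that `R` moves by `-y`. The basis is presented by operators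
`a y j ∈ 𝒟_y` that create its vectors from `|q₀⟩`, together with the operators `b y j` that `R`
carries them to; the label `zero y` stands for `|q₀⟩` itself. -/
structure ComponentFrame (N : Finset (Fin n → ℤ)) (R : Op (Fin n → ℤ) q₀) where
  dim : N → ℕ
  zero : Label dim
  a : (y : N) → Fin (dim y) → Module.End ℂ W
  b : (y : N) → Fin (dim y) → Module.End ℂ W
  intertwines : ∀ (y : N) j, Intertwines R y (a y j) (b y j)
  a_zero : ∀ y, a y (zero y) = 1
  b_zero : ∀ y, b y (zero y) = 1
  orthonormal : ∀ y, Orthonormal ℂ fun j => a y j (siteKet q₀)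
  closed : ∀ (y : N) A B, Intertwines R y A B → ∀ j,
    ∃ c : Fin (dim y) → ℂ, A (a y j (siteKet q₀)) = ∑ i, c i • a y i (siteKet q₀)

theorem exists_frame_at (R : Op (Fin n → ℤ) q₀) (y : Fin n → ℤ) :
    ∃ (d : ℕ) (k₀ : Fin d) (a b : Fin d → Module.End ℂ W),
      (∀ j, Intertwines R y (a j) (b j)) ∧ a k₀ = 1 ∧ b k₀ = 1 ∧
      Orthonormal ℂ (fun j => a j (siteKet q₀)) ∧
      ∀ A B, Intertwines R y A B → ∀ j,
        ∃ c : Fin d → ℂ, A (a j (siteKet q₀)) = ∑ i, c i • a i (siteKet q₀) := by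
  classical
  let V : Submodule ℂ W := (movable R y).map (LinearMap.applyₗ (siteKet q₀))
  have hV : ∀ A B : Module.End ℂ W, Intertwines R y A B → A (siteKet q₀) ∈ V := fun A B h =>
    ⟨A, ⟨B, h⟩, rfl⟩
  let ω : V := ⟨siteKet q₀, hV 1 1 Intertwines.one⟩
  have hω : ‖ω‖ = 1 := by
    rw [Submodule.coe_norm]
    simp [ω, siteKet]
  have hω0 : ω ≠ 0 := fun h => by simp [h] at hω
  have hpos : 0 < Module.finrank ℂ V := by
    have : Nontrivial V := ⟨ω, 0, hω0⟩
    exact Module.finrank_pos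
  let k₀ : Fin (Module.finrank ℂ V) := ⟨0, hpos⟩
  obtain ⟨e, he⟩ := Orthonormal.exists_orthonormalBasis_extension_of_card_eq (𝕜 := ℂ) (E := V)
    (ι := Fin (Module.finrank ℂ V)) (by simp) (v := fun _ => ω) (s := {k₀})
    (by
      refine ⟨fun _ => hω, fun i j hij => ?_⟩
      exact absurd (Subsingleton.elim i j) hij)
  have hk₀ : e k₀ = ω := he k₀ rfl
  -- Any operator creating the basis vector will do, but for the vector `|q₀⟩` it is chosen as `1`.
  have hex : ∀ j, ∃ p : Module.End ℂ W × Module.End ℂ W, Intertwines R y p.1 p.2 ∧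
      p.1 (siteKet q₀) = e j ∧ (j = k₀ → p = 1) := by
    intro j
    by_cases hj : j = k₀
    · subst hj
      exact ⟨1, Intertwines.one, by rw [hk₀]; rfl, fun _ => rfl⟩
    · obtain ⟨A, ⟨B, h⟩, hA⟩ := (e j).2
      exact ⟨(A, B), h, hA, fun h => absurd h hj⟩
  choose p hp hpe hp1 using hex
  refine ⟨_, k₀, fun j => (p j).1, fun j => (p j).2, hp, by simp [hp1 k₀ rfl], by simp [hp1 k₀ rfl],
    ?_, ?_⟩
  · simp only [hpe]
    exact e.orthonormal.comp_linearIsometry V.subtypeₗᵢ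
  · intro A B h j
    let v : V := ⟨A ((p j).1 (siteKet q₀)), hV _ _ (h.mul (hp j))⟩
    refine ⟨fun i => e.repr v i, ?_⟩
    have := congrArg (Subtype.val) (e.sum_repr v)
    simpa [hpe, v] using this.symm

theorem exists_componentFrame (N : Finset (Fin n → ℤ)) (R : Op (Fin n → ℤ) q₀) :
    Nonempty (ComponentFrame N R) := by
  choose d k₀ a b h1 h2 h3 h4 h5 using fun y : N => exists_frame_at R (y : Fin n → ℤ)
  exact ⟨⟨d, k₀, a, b, h1, h2, h3, h4, h5⟩⟩

end Frames

section FamilyVectors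

theorem prod_ite_eq {ι : Type*} {d : ι → ℕ} {l : List ι} (hl : ∀ y, y ∈ l)
    (m m' : Label d) [Decidable (m = m')] :
    (l.map fun y => if m y = m' y then (1 : ℂ) else 0).prod = if m = m' then 1 else 0 := by
  by_cases h : m = m'
  · subst h; simp
  · obtain ⟨y, hy⟩ := Function.ne_iff.1 h
    rw [if_neg h, List.prod_eq_zero]
    exact List.mem_map.2 ⟨y, hl y, if_neg hy⟩

theorem list_prod_mem {ι V : Type*} [AddCommGroup V] [Module ℂ V] (S : Submodule ℂ V)
    (A : ι → Module.End ℂ V)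
    (hA : ∀ i, ∀ v ∈ S, A i v ∈ S) (l : List ι) : ∀ v ∈ S, (l.map A).prod v ∈ S := by
  induction l with
  | nil => intro v hv; exact hv
  | cons i l ih => intro v hv; exact hA i _ (ih v hv)

variable {Q : Type*} [Fintype Q] {ι : Type*} {d : ι → ℕ}

local notation "W" => EuclideanSpace ℂ Q

/-- The vector `∏_y c y (m y) |q₀⟩`. -/
def famVec (l : List ι) (c : (y : ι) → Fin (d y) → Module.End ℂ W) (q₀ : Q) (m : Label d) : W :=
  (l.map fun y => c y (m y)).prod (siteKet q₀)

variable {l : List ι} {c : (y : ι) → Fin (d y) → Module.End ℂ (EuclideanSpace ℂ Q)} {q₀ : Q}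

theorem famVec_zero {k₀ : Label d} (hk₀ : ∀ y, c y (k₀ y) = 1) :
    famVec l c q₀ k₀ = siteKet q₀ := by
  rw [famVec, List.prod_eq_one]
  · rfl
  · intro T hT
    obtain ⟨y, _, rfl⟩ := List.mem_map.1 hT
    exact hk₀ y

variable [DecidableEq ι]

theorem famVec_update (hl : l.Nodup)
    (hc : ∀ y y', y ≠ y' → ∀ i j, Commute (c y i) (c y' j)) {y : ι} (hy : y ∈ l) (m : Label d)
    (i : Fin (d y)) :
    famVec l c q₀ (Function.update m y i) =
      c y i ((l.map (Function.update (fun z => c z (m z)) y 1)).prod (siteKet q₀)) := by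
  rw [famVec, list_prod_eq_mul_update hl (fun z z' h => hc z z' h _ _) hy, Module.End.mul_apply,
    Function.update_self]
  congr 3
  refine List.map_congr_left fun z _ => ?_
  by_cases hz : z = y
  · subst hz; simp
  · simp [hz]

/-- An operator that commutes with all factors but those of the component `y` acts on the component
`y` only. -/
theorem apply_famVec (hl : l.Nodup)
    (hc : ∀ y y', y ≠ y' → ∀ i j, Commute (c y i) (c y' j)) {y : ι} (hy : y ∈ l) (m : Label d)
    (A : Module.End ℂ W) (hA : ∀ z, z ≠ y → ∀ i, Commute A (c z i)) (α : Fin (d y) → ℂ)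
    (hα : A (c y (m y) (siteKet q₀)) = ∑ i, α i • c y i (siteKet q₀)) :
    A (famVec l c q₀ m) = ∑ i, α i • famVec l c q₀ (Function.update m y i) := by
  have hcomm : ∀ B : Module.End ℂ W, (∀ z, z ≠ y → ∀ i, Commute B (c z i)) → ∀ v,
      B ((l.map (Function.update (fun z => c z (m z)) y 1)).prod v) =
        (l.map (Function.update (fun z => c z (m z)) y 1)).prod (B v) := by
    intro B hB v
    rw [← Module.End.mul_apply, ← Module.End.mul_apply]
    refine congrArg (fun T : Module.End ℂ W => T v) (Commute.list_prod_right _ _ fun T hT => ?_)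
    obtain ⟨z, _, rfl⟩ := List.mem_map.1 hT
    by_cases hz : z = y
    · subst hz; simp
    · simpa [hz] using hB z hz _
  have h1 : ∀ i, famVec l c q₀ (Function.update m y i) =
      (l.map (Function.update (fun z => c z (m z)) y 1)).prod (c y i (siteKet q₀)) := fun i => by
    rw [famVec_update hl hc hy, hcomm _ fun z hz j => hc _ _ (Ne.symm hz) _ _]
  have h2 := h1 (m y)
  rw [Function.update_eq_self] at h2
  rw [h2, hcomm A hA, hα, map_sum]
  simp only [map_smul, h1]

/-- `c y j` creates a particle in the state `j` at an empty component `y`. -/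
theorem apply_famVec_of_eq_zero (hl : l.Nodup)
    (hc : ∀ y y', y ≠ y' → ∀ i j, Commute (c y i) (c y' j)) {k₀ : Label d}
    (hk₀ : ∀ y, c y (k₀ y) = 1) {y : ι} (hy : y ∈ l) (m : Label d) (hm : m y = k₀ y)
    (j : Fin (d y)) : c y j (famVec l c q₀ m) = famVec l c q₀ (Function.update m y j) := by
  rw [famVec_update hl hc hy]
  conv_lhs => rw [← Function.update_eq_self y m, famVec_update hl hc hy, hm, hk₀]
  rfl

theorem famVec_update_zero (hl : l.Nodup)
    (hc : ∀ y y', y ≠ y' → ∀ i j, Commute (c y i) (c y' j)) {k₀ : Label d}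
    (hk₀ : ∀ y, c y (k₀ y) = 1) {y : ι} (hy : y ∈ l) (j : Fin (d y)) :
    famVec l c q₀ (Function.update k₀ y j) = c y j (siteKet q₀) := by
  rw [← apply_famVec_of_eq_zero hl hc hk₀ hy k₀ rfl, famVec_zero hk₀]

end FamilyVectors

namespace ComponentFrame

variable {n : ℕ} {Q : Type*} {q₀ : Q} [Fintype Q] {N : Finset (Fin n → ℤ)}
  {R : Op (Fin n → ℤ) q₀} (G : ComponentFrame N R)

local notation "W" => EuclideanSpace ℂ Q

/-- The vectors `∏_y a y (m y) |q₀⟩`, which turn out to be an orthonormal basis of the cell. -/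
def cellVec (m : Label G.dim) : W := famVec (nbhdList N) G.a q₀ m

/-- The vectors `∏_y b y (m y) |q₀⟩`: the images of the vectors `cellVec` under the collision
operator. -/
def collidedVec (m : Label G.dim) : W := famVec (nbhdList N) G.b q₀ m

theorem commute_a (hU : R ∈ unitary (Op (Fin n → ℤ) q₀)) (y y' : N) (h : y ≠ y') (i j) :
    Commute (G.a y i) (G.a y' j) :=
  (G.intertwines y i).commute_left hU (fun e => h (Subtype.ext e)) (G.intertwines y' j)

theorem commute_b (hU : R ∈ unitary (Op (Fin n → ℤ) q₀)) (y y' : N) (h : y ≠ y') (i j) :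
    Commute (G.b y i) (G.b y' j) :=
  (G.intertwines y i).commute_right hU (fun e => h (Subtype.ext e)) (G.intertwines y' j)

theorem orthonormal_vecs (hU : R ∈ unitary (Op (Fin n → ℤ) q₀)) {phase : ℂ}
    (hphase : ‖phase‖ = 1)
    (hvac : R (ket (vac (Fin n → ℤ) q₀)) = phase • ket (vac (Fin n → ℤ) q₀)) :
    Orthonormal ℂ G.cellVec ∧ Orthonormal ℂ G.collidedVec := by
  classical
  have ha : ∀ y i j, ⟪G.a y i (siteKet q₀), G.a y j (siteKet q₀)⟫_ℂ = if i = j then 1 else 0 :=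
    fun y => orthonormal_iff_ite.1 (G.orthonormal y)
  have hb : ∀ y i j, ⟪G.b y i (siteKet q₀), G.b y j (siteKet q₀)⟫_ℂ = if i = j then 1 else 0 :=
    fun y i j => by
      rw [(G.intertwines y i).inner_eq hU hphase hvac (G.intertwines y j), ha]
  have key := fun m m' : Label G.dim => inner_list_prod_of_intertwines hU hphase hvac
    (p := fun y : N => (y : Fin n → ℤ)) Subtype.val_injective
    (fun y => G.intertwines y (m y)) (fun y => G.intertwines y (m' y)) (nodup_nbhdList N)
  rw [orthonormal_iff_ite, orthonormal_iff_ite]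
  constructor
  · intro m m'
    refine (key m m').1.trans ?_
    simp only [hb]
    exact prod_ite_eq mem_nbhdList m m'
  · intro m m'
    refine (key m m').2.trans ?_
    simp only [ha]
    exact prod_ite_eq mem_nbhdList m m'

theorem cellVec_zero : G.cellVec G.zero = siteKet q₀ := famVec_zero G.a_zero

theorem collidedVec_zero : G.collidedVec G.zero = siteKet q₀ := famVec_zero G.b_zero

theorem cellVec_update_zero (hU : R ∈ unitary (Op (Fin n → ℤ) q₀)) (y : N) (j : Fin (G.dim y)) :
    G.cellVec (Function.update G.zero y j) = G.a y j (siteKet q₀) :=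
  famVec_update_zero (nodup_nbhdList N) (G.commute_a hU) G.a_zero (mem_nbhdList y) j

/-- An operator that `R` moves by `-y` acts only on the component `y` of the vectors `cellVec`. -/
theorem exists_apply_cellVec (hU : R ∈ unitary (Op (Fin n → ℤ) q₀)) {y : N}
    {A B : Module.End ℂ W} (h : Intertwines R y A B) :
    ∃ e : Fin (G.dim y) → Fin (G.dim y) → ℂ, ∀ m,
      A (G.cellVec m) = ∑ i, e (m y) i • G.cellVec (Function.update m y i) := by
  choose e he using G.closed y A B h
  refine ⟨e, fun m => apply_famVec (nodup_nbhdList N) (G.commute_a hU) (mem_nbhdList y) m A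
    (fun z hz i => ?_) (e (m y)) (he (m y))⟩
  exact h.commute_left hU (fun e => hz (Subtype.ext e.symm)) (G.intertwines z i)

/-- The products that span the cell algebra under the local condition. -/
def products (N : Finset (Fin n → ℤ)) (R : Op (Fin n → ℤ) q₀) : Set (Module.End ℂ W) :=
  {X | ∃ A B : N → Module.End ℂ W, (∀ y : N, Intertwines R y (A y) (B y)) ∧
    X = ((nbhdList N).map A).prod}

theorem span_products_eq_top (hU : R ∈ unitary (Op (Fin n → ℤ) q₀))
    (hT : IsTranslationInvariant R) (hL : LocalCondition N R) (X : Module.End ℂ W) :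
    X ∈ Submodule.span ℂ (products N R) := by
  have hX : (cellHom q₀ (0 : Fin n → ℤ)).toLinearMap X ∈ cellAlgebra q₀ (0 : Fin n → ℤ) := ⟨X, rfl⟩
  rw [hL 0, SetLike.mem_coe] at hX
  have hsub : {T : Op (Fin n → ℤ) q₀ | ∃ t : (Fin n → ℤ) → Op (Fin n → ℤ) q₀,
      (∀ y ∈ N, t y ∈ localPiece R (0 - y) 0) ∧ T = (N.toList.map t).prod} ⊆
      (cellHom q₀ (0 : Fin n → ℤ)).toLinearMap '' products N R := by
    rintro _ ⟨t, ht, rfl⟩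
    choose A B hA hAB using fun y : N => exists_intertwines_of_mem_localPiece hU hT (ht y y.2)
    refine ⟨_, ⟨A, B, hAB, rfl⟩, ?_⟩
    change cellOp 0 _ = _
    rw [cellOp_list_prod, ← nbhdList_map_val, List.map_map]
    exact congrArg List.prod (List.map_congr_left fun y _ => (hA y).symm)
  have h2 := Submodule.span_mono hsub hX
  rw [← Submodule.map_span] at h2
  obtain ⟨Y, hY, hYX⟩ := h2
  rwa [cellOp_injective (q₀ := q₀) (0 : Fin n → ℤ) hYX] at hY

/-- The vectors `cellVec` span the cell: their span contains `|q₀⟩` and is invariant under the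
whole cell algebra. -/
theorem span_cellVec (hU : R ∈ unitary (Op (Fin n → ℤ) q₀))
    (hT : IsTranslationInvariant R) (hL : LocalCondition N R) :
    ⊤ ≤ Submodule.span ℂ (Set.range G.cellVec) := by
  have hinv : ∀ X : Module.End ℂ W, X (siteKet q₀) ∈ Submodule.span ℂ (Set.range G.cellVec) := by
    intro X
    induction span_products_eq_top hU hT hL X using Submodule.span_induction with
    | zero => exact Submodule.zero_mem _
    | add X Y _ _ hX hY => exact Submodule.add_mem _ hX hY
    | smul a X _ hX => exact Submodule.smul_mem _ a hX
    | mem X hX =>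
      obtain ⟨A, B, hAB, rfl⟩ := hX
      refine list_prod_mem _ A (fun y v hv => ?_) _ _ ?_
      · obtain ⟨e, he⟩ := G.exists_apply_cellVec hU (hAB y)
        induction hv using Submodule.span_induction with
        | zero => simp
        | add v w _ _ hv hw => rw [map_add]; exact Submodule.add_mem _ hv hw
        | smul a v _ hv => rw [map_smul]; exact Submodule.smul_mem _ a hv
        | mem v hv =>
          obtain ⟨m, rfl⟩ := hv
          rw [he]
          exact Submodule.sum_mem _ fun i _ => Submodule.smul_mem _ _
            (Submodule.subset_span ⟨_, rfl⟩)
      · rw [← G.cellVec_zero]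
        exact Submodule.subset_span ⟨_, rfl⟩
  -- The rank one operator `|v⟩⟨q₀|` sends `|q₀⟩` to `v`.
  intro v _
  have := hinv (((innerSL ℂ (siteKet q₀)).toLinearMap).smulRight v)
  rwa [LinearMap.smulRight_apply, ContinuousLinearMap.coe_coe, innerSL_apply_apply,
    inner_siteKet_self, one_smul] at this

/-- Slicing: the vacuum expectation over all components but `y` maps every operator on the cell to
one that `R` moves by `-y`. -/
theorem exists_slice (hU : R ∈ unitary (Op (Fin n → ℤ) q₀))
    (hT : IsTranslationInvariant R) (hL : LocalCondition N R) {phase : ℂ}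
    (hphase : ‖phase‖ = 1)
    (hvac : R (ket (vac (Fin n → ℤ) q₀)) = phase • ket (vac (Fin n → ℤ) q₀)) (y : N)
    (X : Module.End ℂ W) :
    ∃ A B : Module.End ℂ W, Intertwines R y A B ∧ ∀ i j,
      ⟪G.a y i (siteKet q₀), A (G.a y j (siteKet q₀))⟫_ℂ =
        ⟪G.a y i (siteKet q₀), X (G.a y j (siteKet q₀))⟫_ℂ := by
  induction span_products_eq_top hU hT hL X using Submodule.span_induction with
  | zero => exact ⟨0, 0, Intertwines.zero, fun i j => rfl⟩
  | add X Y _ _ hX hY =>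
    obtain ⟨A, B, h, hA⟩ := hX
    obtain ⟨A', B', h', hA'⟩ := hY
    refine ⟨_, _, h.add h', fun i j => ?_⟩
    simp only [LinearMap.add_apply, inner_add_right, hA, hA']
  | smul a X _ hX =>
    obtain ⟨A, B, h, hA⟩ := hX
    refine ⟨_, _, h.smul a, fun i j => ?_⟩
    simp only [LinearMap.smul_apply, inner_smul_right, hA]
  | mem X hX =>
    obtain ⟨A, B, hAB, rfl⟩ := hX
    have hl := nodup_nbhdList N
    have hy := mem_nbhdList y
    set l := nbhdList N with hl_def
    refine ⟨_, _, (hAB y).smul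
      (l.map (Function.update (fun z => ⟪siteKet q₀, B z (siteKet q₀)⟫_ℂ) y 1)).prod,
      fun i j => ?_⟩
    have hcomm : ∀ z z', z ≠ z' → Commute (A z) (A z') := fun z z' h =>
      (hAB z).commute_left hU (fun e => h (Subtype.ext e)) (hAB z')
    -- Both sides of the inner product are written as products over all components.
    have e1 : G.a y i = (l.map (Function.update (fun _ => 1) y (G.a y i))).prod := by
      rw [list_prod_eq_mul_update hl _ hy]
      · rw [Function.update_self, Function.update_idem, List.prod_eq_one, mul_one]
        intro T hT
        obtain ⟨z, _, rfl⟩ := List.mem_map.1 hT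
        by_cases hz : z = y
        · subst hz; simp
        · simp [hz]
      · intro z z' h
        by_cases hz : z = y
        · subst hz; simp [Function.update_of_ne h.symm]
        · simp [hz]
    have e2 : (l.map A).prod * G.a y j =
        (l.map (Function.update A y (A y * G.a y j))).prod := by
      have hc : ∀ z, z ≠ y → Commute (A z) (A y * G.a y j) := fun z hz =>
        (hAB z).commute_left hU (fun e => hz (Subtype.ext e)) ((hAB y).mul (G.intertwines y j))
      have hc' : ∀ z, z ≠ y → Commute (A z) (G.a y j) := fun z hz =>
        (hAB z).commute_left hU (fun e => hz (Subtype.ext e)) (G.intertwines y j)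
      rw [list_prod_eq_mul_update hl hcomm hy,
        list_prod_eq_mul_update (g := Function.update A y (A y * G.a y j)) hl _ hy,
        Function.update_self, Function.update_idem, mul_assoc, mul_assoc]
      · refine congrArg (A y * ·) (Commute.eq ?_)
        refine Commute.list_prod_left (M := Module.End ℂ W) _ _ fun T hT => ?_
        obtain ⟨z, _, rfl⟩ := List.mem_map.1 hT
        by_cases hz : z = y
        · subst hz; simp
        · simpa [hz] using hc' z hz
      · intro z z' h
        by_cases hz : z = y
        · subst hz
          simpa [Function.update_of_ne h.symm] using (hc z' h.symm).symm
        · by_cases hz' : z' = y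
          · subst hz'
            simpa [Function.update_of_ne h] using hc z h
          · simpa [hz, hz'] using hcomm z z' h
    have i1 : ∀ z : N, Intertwines R z
        (Function.update (fun _ : N => (1 : Module.End ℂ W)) y (G.a y i) z)
        (Function.update (fun _ : N => (1 : Module.End ℂ W)) y (G.b y i) z) := fun z => by
      by_cases hz : z = y
      · subst hz
        rw [Function.update_self, Function.update_self]
        exact G.intertwines z i
      · rw [Function.update_of_ne hz, Function.update_of_ne hz]
        exact Intertwines.one
    have i2 : ∀ z : N, Intertwines R z (Function.update A y (A y * G.a y j) z)
        (Function.update B y (B y * G.b y j) z) := fun z => by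
      by_cases hz : z = y
      · subst hz
        rw [Function.update_self, Function.update_self]
        exact (hAB z).mul (G.intertwines z j)
      · rw [Function.update_of_ne hz, Function.update_of_ne hz]
        exact hAB z
    have key := (inner_list_prod_of_intertwines hU hphase hvac
      (p := fun y : N => (y : Fin n → ℤ)) Subtype.val_injective i1 i2 hl).1
    rw [← e1, ← e2, list_prod_eq_mul_update (M := ℂ) hl (fun _ _ _ => Commute.all _ _) hy] at key
    simp only [Function.update_self] at key
    have e3 := ((G.intertwines y i).inner_eq hU hphase hvac ((hAB y).mul (G.intertwines y j)))
    rw [e3] at key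
    rw [LinearMap.smul_apply, inner_smul_right, ← Module.End.mul_apply, ← Module.End.mul_apply,
      key, mul_comm]
    congr 2
    refine List.map_congr_left fun z _ => ?_
    by_cases hz : z = y
    · subst hz; simp
    · simp [hz]

end ComponentFrame

/-! ### The lattice gas of a quantum cellular automaton -/

/-- The vacuum is the only translation invariant state, so `R` preserves it up to a phase. -/
theorem exists_eigenvalue_vac {n : ℕ} (hn : 0 < n) {Q : Type*} {q₀ : Q}
    {R : Op (Fin n → ℤ) q₀} (hU : R ∈ unitary (Op (Fin n → ℤ) q₀))
    (hT : IsTranslationInvariant R) :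
    ∃ phase : ℂ, ‖phase‖ = 1 ∧
      R (ket (vac (Fin n → ℤ) q₀)) = phase • ket (vac (Fin n → ℤ) q₀) := by
  have h := eq_smul_vac_of_invariant hn (R (ket (vac (Fin n → ℤ) q₀))) fun z => by
    rw [translation_comm hT, translation_ket]
    rfl
  refine ⟨_, ?_, h⟩
  have h1 : ‖R (ket (vac (Fin n → ℤ) q₀))‖ = ‖ket (vac (Fin n → ℤ) q₀)‖ := by
    rw [@norm_eq_sqrt_re_inner ℂ, inner_map_of_unitary hU, ← @norm_eq_sqrt_re_inner ℂ]
  rw [h, norm_smul, orthonormal_l2ket.1, mul_one] at h1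
  exact h1

namespace ComponentFrame

variable {n : ℕ} {Q : Type*} {q₀ : Q} [Fintype Q] {N : Finset (Fin n → ℤ)}
  {R : Op (Fin n → ℤ) q₀} (G : ComponentFrame N R)

/-- Operators on the cell `x` that `R` moves to the cell `x - y` are, in a basis `S` adapted to the
frame, exactly the operators on the component `y`. -/
theorem localPiece_eq (hU : R ∈ unitary (Op (Fin n → ℤ) q₀))
    (hT : IsTranslationInvariant R) (hL : LocalCondition N R) {phase : ℂ}
    (hphase : ‖phase‖ = 1)
    (hvac : R (ket (vac (Fin n → ℤ) q₀)) = phase • ket (vac (Fin n → ℤ) q₀))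
    (S : EuclideanSpace ℂ Q ≃ₗᵢ[ℂ] CellSpace G.dim)
    (hS : ∀ m, S.symm (siteKet m) = G.cellVec m) (x : Fin n → ℤ) (y : N) :
    localPiece R (x - y) x =
      {T | ∃ e : Component G.dim y →ₗ[ℂ] Component G.dim y,
        T = cellOp x (S.symm.toLinearEquiv.toLinearMap ∘ₗ onComponent G.dim y e ∘ₗ
          S.toLinearEquiv.toLinearMap)} := by
  have hS' : ∀ m, S (G.cellVec m) = siteKet m := fun m => by rw [← hS, S.apply_symm_apply]
  -- An operator on the component `y`, transported to the cell, in the basis `cellVec`.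
  have hconj : ∀ (e : Component G.dim y →ₗ[ℂ] Component G.dim y) (m : Label G.dim),
      S.symm (onComponent G.dim y e (S (G.cellVec m))) =
        ∑ i, e (siteKet (m y)) i • G.cellVec (Function.update m y i) := fun e m => by
    simp only [hS', onComponent_siteKet, map_sum, map_smul, hS]
  have hsub : ∀ {A B : Module.End ℂ (EuclideanSpace ℂ Q)}, Intertwines R y A B →
      ∃ e : Component G.dim y →ₗ[ℂ] Component G.dim y,
        A = S.symm.toLinearEquiv.toLinearMap ∘ₗ onComponent G.dim y e ∘ₗ
          S.toLinearEquiv.toLinearMap := by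
    intro A B h
    obtain ⟨c, hc⟩ := G.exists_apply_cellVec hU h
    refine ⟨ofColumns fun j => ∑ i, c j i • siteKet i, ?_⟩
    have : A ∘ₗ S.symm.toLinearEquiv.toLinearMap =
        (S.symm.toLinearEquiv.toLinearMap ∘ₗ
          onComponent G.dim y (ofColumns fun j => ∑ i, c j i • siteKet i) ∘ₗ
          S.toLinearEquiv.toLinearMap) ∘ₗ S.symm.toLinearEquiv.toLinearMap := by
      refine linearMap_ext_siteKet fun m => ?_
      change A (S.symm (siteKet m)) = S.symm (onComponent G.dim y _ (S (S.symm (siteKet m))))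
      rw [hS, hc, hconj]
      refine Finset.sum_congr rfl fun i _ => ?_
      rw [ofColumns_siteKet, ← eq_sum_siteKet (WithLp.toLp 2 fun i => c (m y) i)]
    refine LinearMap.ext fun v => ?_
    have := congrArg (fun T => T (S v)) this
    simpa using this
  ext T
  constructor
  · intro hTm
    obtain ⟨A, B, rfl, h⟩ := exists_intertwines_of_mem_localPiece hU hT hTm
    obtain ⟨e, he⟩ := hsub h
    exact ⟨e, by rw [← he]⟩
  · rintro ⟨e, rfl⟩
    obtain ⟨A, B, h, hA⟩ := G.exists_slice hU hT hL hphase hvac y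
      (S.symm.toLinearEquiv.toLinearMap ∘ₗ onComponent G.dim y e ∘ₗ S.toLinearEquiv.toLinearMap)
    obtain ⟨e', he'⟩ := hsub h
    -- The slice of an operator on the component `y` is that operator.
    have hentry : ∀ (e : Component G.dim y →ₗ[ℂ] Component G.dim y) i j,
        ⟪G.a y i (siteKet q₀), (S.symm.toLinearEquiv.toLinearMap ∘ₗ onComponent G.dim y e ∘ₗ
          S.toLinearEquiv.toLinearMap) (G.a y j (siteKet q₀))⟫_ℂ = e (siteKet j) i := by
      intro e i j
      have h1 := hconj e (Function.update G.zero y j)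
      simp only [Function.update_self, Function.update_idem, G.cellVec_update_zero hU] at h1
      change ⟪_, S.symm (onComponent G.dim y e (S (G.a y j (siteKet q₀))))⟫_ℂ = _
      rw [h1, (G.orthonormal y).inner_right_fintype]
    have hee : e = e' := by
      refine linearMap_ext_siteKet fun j => ?_
      ext i
      rw [← hentry, ← hentry, ← he', hA]
    rw [hee, ← he']
    exact mem_localPiece_of_intertwines hU h x

theorem finite_cellVec_ne (k : Config (Fin n → ℤ) G.zero) :
    {x | G.cellVec (k.1 x) ≠ siteKet q₀}.Finite :=
  k.2.subset fun z hz hz' => hz (by rw [hz', cellVec_zero])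

theorem finite_collidedVec_ne (k : Config (Fin n → ℤ) G.zero) :
    {x | G.collidedVec (k.1 x) ≠ siteKet q₀}.Finite :=
  k.2.subset fun z hz hz' => hz (by rw [hz', collidedVec_zero])

/-- `R` acts on product vectors as propagation followed by collision: this is proved by adding
particles (components in a state other than the vacuum) one at a time. -/
theorem apply_prodVec (hU : R ∈ unitary (Op (Fin n → ℤ) q₀)) {phase : ℂ}
    (hvac : R (ket (vac (Fin n → ℤ) q₀)) = phase • ket (vac (Fin n → ℤ) q₀))
    (k : Config (Fin n → ℤ) G.zero) (h h') :
    R (prodVec (fun x => G.cellVec (k.1 x)) h) =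
      phase • prodVec (fun x => G.collidedVec ((propagate G.zero k).1 x)) h' := by
  classical
  have hl := nodup_nbhdList N
  have key : ∀ (T : Finset ((Fin n → ℤ) × N)) (k : Config (Fin n → ℤ) G.zero),
      (∀ x y, k.1 x y ≠ G.zero y → (x, y) ∈ T) → ∀ h h',
      R (prodVec (fun x => G.cellVec (k.1 x)) h) =
        phase • prodVec (fun x => G.collidedVec ((propagate G.zero k).1 x)) h' := by
    intro T
    induction T using Finset.induction_on with
    | empty =>
      intro k hk h h'
      have hk0 : k = vac (Fin n → ℤ) G.zero := Subtype.ext (funext fun x => funext fun y => by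
        by_contra hne
        simpa using hk x y hne)
      subst hk0
      have e1 : (fun x => G.cellVec ((vac (Fin n → ℤ) G.zero).1 x)) =
          fun x => siteKet ((vac (Fin n → ℤ) q₀).1 x) := funext fun x => G.cellVec_zero
      have e2 : (fun x => G.collidedVec ((propagate G.zero (vac (Fin n → ℤ) G.zero)).1 x)) =
          fun x => siteKet ((vac (Fin n → ℤ) q₀).1 x) := funext fun x => G.collidedVec_zero
      rw [prodVec_congr e1 h (finite_siteKet_ne _), prodVec_congr e2 h' (finite_siteKet_ne _),
        ← ket_eq_prodVec, hvac]
    | insert p T hp ih =>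
      obtain ⟨x, y⟩ := p
      intro k hk h h'
      set j := k.1 x y with hj
      -- The configuration without the particle at the component `y` of the cell `x`.
      set k' : Config (Fin n → ℤ) G.zero :=
        setAt k x (Function.update (k.1 x) y (G.zero y)) with hk'
      have hk'x : k'.1 x = Function.update (k.1 x) y (G.zero y) := by simp [hk', setAt]
      have hk'x' : ∀ z, z ≠ x → k'.1 z = k.1 z := fun z hz => by simp [hk', setAt, hz]
      have hk'T : ∀ z w, k'.1 z w ≠ G.zero w → (z, w) ∈ T := by
        intro z w hzw
        by_cases hz : z = x
        · subst hz
          rw [hk'x] at hzw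
          by_cases hw : w = y
          · subst hw; simp at hzw
          · rw [Function.update_of_ne hw] at hzw
            have := hk _ _ hzw
            simpa [hw] using this
        · rw [hk'x' z hz] at hzw
          have := hk _ _ hzw
          simpa [hz] using this
      have hfin := G.finite_cellVec_ne k'
      have hfin' := G.finite_collidedVec_ne (propagate G.zero k')
      have e1 : (fun z => G.cellVec (k.1 z)) =
          Function.update (fun z => G.cellVec (k'.1 z)) x (G.a y j (G.cellVec (k'.1 x))) := by
        funext z
        by_cases hz : z = x
        · subst hz
          rw [Function.update_self, hk'x]
          refine Eq.trans ?_ (apply_famVec_of_eq_zero hl (G.commute_a hU) G.a_zero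
            (mem_nbhdList y) _ (by simp) j).symm
          rw [Function.update_idem, hj, Function.update_eq_self]
          rfl
        · rw [Function.update_of_ne hz, hk'x' z hz]
      have e2 : (fun z => G.collidedVec ((propagate G.zero k).1 z)) =
          Function.update (fun z => G.collidedVec ((propagate G.zero k').1 z)) (x - y)
            (G.b y j (G.collidedVec ((propagate G.zero k').1 (x - y)))) := by
        funext z
        by_cases hz : z = x - y
        · subst hz
          rw [Function.update_self]
          refine Eq.trans ?_ (apply_famVec_of_eq_zero hl (G.commute_b hU) G.b_zero
            (mem_nbhdList y) _ (by simp [propagate, hk'x]) j).symm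
          change famVec _ _ _ _ = _
          congr 1
          funext w
          change k.1 (x - y + w) w = Function.update (fun w : N => k'.1 (x - y + w) w) y j w
          by_cases hw : w = y
          · subst hw; simp [hj]
          · rw [Function.update_of_ne hw]
            by_cases hx : x - y + w = x
            · rw [hx, hk'x, Function.update_of_ne hw]
            · rw [hk'x' _ hx]
        · rw [Function.update_of_ne hz]
          congr 1
          funext w
          change k.1 (z + w) w = k'.1 (z + w) w
          by_cases hx : z + w = x
          · have hw : w ≠ y := fun e => hz (by rw [← hx, e, add_sub_cancel_right])
            rw [hx, hk'x, Function.update_of_ne hw]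
          · rw [hk'x' _ hx]
      rw [prodVec_congr e1 h (finite_update_ne hfin x _), ← cellOp_prodVec x _ _ hfin,
        ← mul_apply_eq_comp, G.intertwines y j x, mul_apply_eq_comp, ih k' hk'T hfin hfin',
        map_smul, cellOp_prodVec, prodVec_congr e2 h' (finite_update_ne hfin' (x - y) _)]
  have hfin : {p : (Fin n → ℤ) × N | k.1 p.1 p.2 ≠ G.zero p.2}.Finite :=
    (k.2.prod (Set.finite_univ (α := N))).subset fun p hp =>
      ⟨fun e => hp (by rw [e]), Set.mem_univ _⟩
  exact key hfin.toFinset k (fun x y hxy => by simpa using hxy) h h'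

end ComponentFrame

/-- A quantum cellular automaton that satisfies the local condition is a lattice gas up to a
phase. -/
theorem exists_latticeGas {n : ℕ} (hn : 0 < n) {Q : Type*} [Fintype Q] {q₀ : Q}
    {N : Finset (Fin n → ℤ)} {R : Op (Fin n → ℤ) q₀} (hU : R ∈ unitary (Op (Fin n → ℤ) q₀))
    (hT : IsTranslationInvariant R) (hL : LocalCondition N R) :
    ∃ (d : N → ℕ) (k₀ : Label d)
      (S : EuclideanSpace ℂ Q ≃ₗᵢ[ℂ] CellSpace d)
      (hS : S (siteKet q₀) = siteKet k₀)
      (F : CellSpace d ≃ₗᵢ[ℂ] CellSpace d)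
      (hF : F (siteKet k₀) = siteKet k₀)
      (phase : ℂ),
      (∀ (x : Fin n → ℤ) (y : N), localPiece R (x - y) x =
        {T | ∃ e : Component d y →ₗ[ℂ] Component d y,
          T = cellOp x (S.symm.toLinearEquiv.toLinearMap ∘ₗ onComponent d y e ∘ₗ
            S.toLinearEquiv.toLinearMap)}) ∧
      ‖phase‖ = 1 ∧
      R (ket (vac (Fin n → ℤ) q₀)) = phase • ket (vac (Fin n → ℤ) q₀) ∧
      ∀ f : ConfigSpace (Fin n → ℤ) q₀,
        R f = phase • (cellwise (Fin n → ℤ) S hS).symm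
          (cellwise (Fin n → ℤ) F hF (propagation k₀
            (cellwise (Fin n → ℤ) S hS f))) := by
  classical
  obtain ⟨phase, hphase, hvac⟩ := exists_eigenvalue_vac hn hU hT
  obtain ⟨G⟩ := exists_componentFrame N R
  obtain ⟨ho, ho'⟩ := G.orthonormal_vecs hU hphase hvac
  let sB : OrthonormalBasis (Label G.dim) ℂ (EuclideanSpace ℂ Q) :=
    OrthonormalBasis.mk ho (G.span_cellVec hU hT hL)
  let fB : OrthonormalBasis (Label G.dim) ℂ (EuclideanSpace ℂ Q) :=
    OrthonormalBasis.mk ho' (by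
      have := ho'.linearIndependent.span_eq_top_of_card_eq_finrank'
        (Module.finrank_eq_card_basis sB.toBasis).symm
      exact this.ge)
  let S := sB.repr
  let F := fB.repr.symm.trans S
  have hSs : ∀ m, S.symm (siteKet m) = G.cellVec m := fun m => by
    simp [S, siteKet, sB]
  have hSv : ∀ m, S (G.cellVec m) = siteKet m := fun m => by rw [← hSs, S.apply_symm_apply]
  have hFs : ∀ m, F (siteKet m) = S (G.collidedVec m) := fun m => by
    simp [F, siteKet, fB]
  have hS : S (siteKet q₀) = siteKet G.zero := by rw [← G.cellVec_zero, hSv]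
  have hF : F (siteKet G.zero) = siteKet G.zero := by rw [hFs, G.collidedVec_zero, hS]
  have hS' : S.symm (siteKet G.zero) = siteKet q₀ := by rw [hSs, G.cellVec_zero]
  refine ⟨G.dim, G.zero, S, hS, F, hF, phase,
    G.localPiece_eq hU hT hL hphase hvac S hSs, hphase, hvac, fun f => ?_⟩
  -- It suffices to compare the two sides on the vectors `S⁻¹ |k⟩`.
  obtain ⟨g, rfl⟩ := (cellwise (Fin n → ℤ) S hS).symm.surjective f
  rw [LinearIsometryEquiv.apply_symm_apply]
  have key : R.comp (cellwise (Fin n → ℤ) S hS).symm.toContinuousLinearEquiv.toContinuousLinearMap =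
      phase • ((cellwise (Fin n → ℤ) S hS).symm.toContinuousLinearEquiv.toContinuousLinearMap.comp
        ((cellwise (Fin n → ℤ) F hF).toContinuousLinearEquiv.toContinuousLinearMap.comp
          (propagation G.zero).toContinuousLinearEquiv.toContinuousLinearMap)) := by
    refine clm_ext_l2ket fun k => ?_
    change R ((cellwise (Fin n → ℤ) S hS).symm (ket k)) =
      phase • (cellwise (Fin n → ℤ) S hS).symm
        (cellwise (Fin n → ℤ) F hF (propagation G.zero (ket k)))
    have hp : propagation G.zero (ket k) = ket (propagate G.zero k) := permUnitary_ket _ _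
    rw [hp, cellwise_symm S hS hS', cellwise_ket, cellwise_ket, cellwise_prodVec]
    have e1 : (fun x => S.symm (siteKet (k.1 x))) = fun x => G.cellVec (k.1 x) :=
      funext fun x => hSs _
    have e2 : (fun x => S.symm (F (siteKet ((propagate G.zero k).1 x)))) =
        fun x => G.collidedVec ((propagate G.zero k).1 x) := funext fun x => by
      rw [hFs, S.symm_apply_apply]
    rw [prodVec_congr e1 _ (G.finite_cellVec_ne k), prodVec_congr e2 _ (G.finite_collidedVec_ne _)]
    exact G.apply_prodVec hU hvac k _ _
  exact congrArg (fun T => T g) key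

/-! ### Hilbert–Schmidt operators and partial traces -/

section HilbertSchmidt

variable {ι H : Type*} [NormedAddCommGroup H] [InnerProductSpace ℂ H]

theorem hasSum_norm_sq_inner (b : HilbertBasis ι ℂ H) (v : H) :
    HasSum (fun i => ‖⟪b i, v⟫_ℂ‖ ^ 2) (‖v‖ ^ 2) := by
  have h := b.hasSum_inner_mul_inner v v
  rw [inner_self_eq_norm_sq_to_K] at h
  have h2 : ∀ i, ⟪v, b i⟫_ℂ * ⟪b i, v⟫_ℂ = ((‖⟪b i, v⟫_ℂ‖ ^ 2 : ℝ) : ℂ) := fun i => by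
    rw [← inner_conj_symm, RCLike.conj_mul]
    norm_cast
  simp only [h2] at h
  have h3 : ((‖v‖ : ℂ) ^ 2) = ((‖v‖ ^ 2 : ℝ) : ℂ) := by norm_cast
  exact Complex.hasSum_ofReal.1 (by rw [← h3]; exact h)

theorem summable_inner_of_norm_sq {κ : Type*} {u v : κ → H} (hu : Summable fun i => ‖u i‖ ^ 2)
    (hv : Summable fun i => ‖v i‖ ^ 2) : Summable fun i => ⟪u i, v i⟫_ℂ := by
  refine Summable.of_norm_bounded (hu.add hv) fun i => ?_
  refine (norm_inner_le_norm _ _).trans ?_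
  nlinarith [sq_nonneg (‖u i‖ - ‖v i‖), sq_nonneg (‖u i‖ + ‖v i‖)]

/-- The matrix of a Hilbert–Schmidt operator is square summable. -/
theorem summable_norm_sq_matrix (b b' : HilbertBasis ι ℂ H) (B : H →L[ℂ] H)
    (hB : Summable fun i => ‖B (b i)‖ ^ 2) :
    Summable fun p : ι × ι => ‖⟪b' p.2, B (b p.1)⟫_ℂ‖ ^ 2 := by
  refine (summable_prod_of_nonneg fun p => sq_nonneg _).2
    ⟨fun i => (hasSum_norm_sq_inner b' (B (b i))).summable, ?_⟩
  simpa only [(hasSum_norm_sq_inner b' _).tsum_eq] using hB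

variable [CompleteSpace H]

theorem exists_eq_adjoint_comp_self {T : H →L[ℂ] H} (hT : T.IsPositive) :
    ∃ B : H →L[ℂ] H, T = ContinuousLinearMap.adjoint B ∘L B :=
  CStarAlgebra.nonneg_iff_eq_star_mul_self.1 ((ContinuousLinearMap.nonneg_iff_isPositive T).2 hT)

/-- The adjoint of a Hilbert–Schmidt operator is Hilbert–Schmidt, in any orthonormal basis. -/
theorem summable_norm_sq_adjoint (b b' : HilbertBasis ι ℂ H) (B : H →L[ℂ] H)
    (hB : Summable fun i => ‖B (b i)‖ ^ 2) :
    Summable fun j => ‖ContinuousLinearMap.adjoint B (b' j)‖ ^ 2 := by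
  have h := (summable_norm_sq_matrix b b' B hB).prod_symm
  have h2 := ((summable_prod_of_nonneg fun p => sq_nonneg _).1 h).2
  refine h2.congr fun j => ?_
  rw [← (hasSum_norm_sq_inner b (ContinuousLinearMap.adjoint B (b' j))).tsum_eq]
  refine tsum_congr fun i => ?_
  rw [Prod.swap_prod_mk, ContinuousLinearMap.adjoint_inner_right, ← norm_inner_symm]

/-- The Hilbert–Schmidt operators are a right ideal: by passing to adjoints, this reduces to
the bound `‖X† B† v‖ ≤ ‖X†‖ ‖B† v‖`. -/
theorem summable_norm_sq_comp (b : HilbertBasis ι ℂ H) (B X : H →L[ℂ] H)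
    (hB : Summable fun i => ‖B (b i)‖ ^ 2) : Summable fun i => ‖B (X (b i))‖ ^ 2 := by
  have h1 := summable_norm_sq_adjoint b b B hB
  have h2 : Summable fun i => ‖ContinuousLinearMap.adjoint (B ∘L X) (b i)‖ ^ 2 := by
    refine Summable.of_nonneg_of_le (fun _ => sq_nonneg _) (fun i => ?_)
      (h1.mul_left (‖ContinuousLinearMap.adjoint X‖ ^ 2))
    rw [ContinuousLinearMap.adjoint_comp, ContinuousLinearMap.comp_apply, ← mul_pow]
    exact pow_le_pow_left₀ (norm_nonneg _) (ContinuousLinearMap.le_opNorm _ _) 2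
  have h3 := summable_norm_sq_adjoint b b _ h2
  rw [ContinuousLinearMap.adjoint_adjoint] at h3
  exact h3

/-- The Hilbert–Schmidt inner product `tr (B† C)` may be computed in any orthonormal basis. -/
theorem tsum_inner_eq_adjoint (b b' : HilbertBasis ι ℂ H) (B C : H →L[ℂ] H)
    (hB : Summable fun i => ‖B (b i)‖ ^ 2) (hC : Summable fun i => ‖C (b i)‖ ^ 2) :
    ∑' i, ⟪B (b i), C (b i)⟫_ℂ =
      ∑' j, ⟪ContinuousLinearMap.adjoint C (b' j), ContinuousLinearMap.adjoint B (b' j)⟫_ℂ := by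
  have hsum : Summable (Function.uncurry fun i j => ⟪B (b i), b' j⟫_ℂ * ⟪b' j, C (b i)⟫_ℂ) := by
    refine Summable.of_norm_bounded ((summable_norm_sq_matrix b b' B hB).add
      (summable_norm_sq_matrix b b' C hC)) fun p => ?_
    simp only [Function.uncurry]
    rw [norm_mul, norm_inner_symm]
    nlinarith [sq_nonneg (‖⟪b' p.2, B (b p.1)⟫_ℂ‖ - ‖⟪b' p.2, C (b p.1)⟫_ℂ‖),
      sq_nonneg (‖⟪b' p.2, B (b p.1)⟫_ℂ‖ + ‖⟪b' p.2, C (b p.1)⟫_ℂ‖)]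
  calc ∑' i, ⟪B (b i), C (b i)⟫_ℂ
      = ∑' i, ∑' j, ⟪B (b i), b' j⟫_ℂ * ⟪b' j, C (b i)⟫_ℂ :=
        tsum_congr fun i => (b'.tsum_inner_mul_inner _ _).symm
    _ = ∑' j, ∑' i, ⟪B (b i), b' j⟫_ℂ * ⟪b' j, C (b i)⟫_ℂ := hsum.tsum_comm.symm
    _ = _ := tsum_congr fun j => by
        rw [← b.tsum_inner_mul_inner]
        refine tsum_congr fun i => ?_
        rw [ContinuousLinearMap.adjoint_inner_left, ContinuousLinearMap.adjoint_inner_right,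
          mul_comm]

/-- Invariance of the trace `tr (B† C)` under a unitary change of basis. -/
theorem tsum_inner_unitary {B C : lp (fun _ : ι => ℂ) 2 →L[ℂ] lp (fun _ : ι => ℂ) 2}
    (U : lp (fun _ : ι => ℂ) 2 ≃ₗᵢ[ℂ] lp (fun _ : ι => ℂ) 2)
    (hB : Summable fun i => ‖B (l2ket i)‖ ^ 2) (hC : Summable fun i => ‖C (l2ket i)‖ ^ 2) :
    ∑' i, ⟪B (U (l2ket i)), C (U (l2ket i))⟫_ℂ = ∑' i, ⟪B (l2ket i), C (l2ket i)⟫_ℂ := by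
  let b : HilbertBasis ι ℂ (lp (fun _ : ι => ℂ) 2) := HilbertBasis.ofRepr (.refl ℂ _)
  let b' : HilbertBasis ι ℂ (lp (fun _ : ι => ℂ) 2) := HilbertBasis.ofRepr U.symm
  have hb : ∀ i, b i = l2ket i := fun i => rfl
  have hb' : ∀ i, b' i = U (l2ket i) := fun i => rfl
  simp only [← hb'] at *
  simp only [← hb] at *
  have hB' := summable_norm_sq_adjoint b b' _ (summable_norm_sq_adjoint b b B hB)
  have hC' := summable_norm_sq_adjoint b b' _ (summable_norm_sq_adjoint b b C hC)
  rw [ContinuousLinearMap.adjoint_adjoint] at hB' hC'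
  rw [tsum_inner_eq_adjoint b b B C hB hC, tsum_inner_eq_adjoint b' b B C hB' hC']

theorem summable_norm_sq_comp_l2ket {B : lp (fun _ : ι => ℂ) 2 →L[ℂ] lp (fun _ : ι => ℂ) 2}
    (X : lp (fun _ : ι => ℂ) 2 →L[ℂ] lp (fun _ : ι => ℂ) 2)
    (hB : Summable fun i => ‖B (l2ket i)‖ ^ 2) : Summable fun i => ‖B (X (l2ket i))‖ ^ 2 :=
  summable_norm_sq_comp (HilbertBasis.ofRepr (.refl ℂ _)) B X hB

end HilbertSchmidt

section Locality

/-- A density operator is `B† B` with `B` Hilbert–Schmidt. -/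
theorem exists_sqrt_of_isDensity {L Q : Type*} {q₀ : Q} {ρ : Op L q₀} (hρ : IsDensity ρ) :
    ∃ B : Op L q₀, ρ = ContinuousLinearMap.adjoint B ∘L B ∧
      Summable fun c : Config L q₀ => ‖B (ket c)‖ ^ 2 := by
  obtain ⟨B, hB⟩ := exists_eq_adjoint_comp_self hρ.1
  refine ⟨B, hB, ?_⟩
  have h := hρ.2.summable
  have h2 : ∀ c : Config L q₀, ⟪ket c, ρ (ket c)⟫_ℂ = ((‖B (ket c)‖ ^ 2 : ℝ) : ℂ) := fun c => by
    rw [hB, ContinuousLinearMap.comp_apply,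
      ContinuousLinearMap.adjoint_inner_right, inner_self_eq_norm_sq_to_K]
    norm_cast
  simp only [h2] at h
  exact Complex.summable_ofReal.1 h


variable {L Q : Type*} [DecidableEq L] {q₀ : Q}

/-- A configuration is the same as a pattern on `D` together with a configuration off `D`. -/
def glueEquiv (q₀ : Q) (D : Finset L) :
    (D → Q) × Config {x // x ∉ D} q₀ ≃ Config L q₀ where
  toFun p := glue D p.1 p.2
  invFun c := (fun x => c.1 x, ⟨fun x => c.1 x, c.2.preimage Subtype.val_injective.injOn⟩)
  left_inv p := by
    refine Prod.ext (funext fun x => ?_) (Subtype.ext (funext fun x => ?_))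
    · simp [glue]
    · simp [glue, x.2]
  right_inv c := by
    refine Subtype.ext (funext fun x => ?_)
    simp [glue]

variable [Fintype Q]

/-- `X` acts on the cells in `D` only, by the matrix `m`. -/
def ActsOn (D : Finset L) (m : Matrix (D → Q) (D → Q) ℂ) (X : Op L q₀) : Prop :=
  ∀ a w, X (ket (glue D a w)) = ∑ b, m b a • ket (glue D b w)

open scoped Classical in
theorem actsOn_one (D : Finset L) : ActsOn D 1 (1 : Op L q₀) := fun a w => by
  simp [Matrix.one_apply]

theorem ActsOn.add {D : Finset L} {m m' : Matrix (D → Q) (D → Q) ℂ} {X X' : Op L q₀}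
    (h : ActsOn D m X) (h' : ActsOn D m' X') : ActsOn D (m + m') (X + X') := fun a w => by
  rw [add_apply, h, h']
  simp [add_smul, Finset.sum_add_distrib]

theorem ActsOn.smul {D : Finset L} {m : Matrix (D → Q) (D → Q) ℂ} {X : Op L q₀}
    (h : ActsOn D m X) (t : ℂ) : ActsOn D (t • m) (t • X) := fun a w => by
  rw [smul_apply, h]
  simp [Finset.smul_sum, smul_smul]

theorem ActsOn.mul {D : Finset L} {m m' : Matrix (D → Q) (D → Q) ℂ} {X X' : Op L q₀}
    (h : ActsOn D m X) (h' : ActsOn D m' X') : ActsOn D (m * m') (X * X') := fun a w => by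
  rw [mul_apply_eq_comp, h', map_sum]
  simp only [map_smul, h _ w, Finset.smul_sum, smul_smul, Matrix.mul_apply, Finset.sum_smul]
  rw [Finset.sum_comm]
  exact Finset.sum_congr rfl fun b _ => Finset.sum_congr rfl fun c _ => by rw [mul_comm]

theorem exists_actsOn_cellOp (D : Finset L) {x : L} (hx : x ∈ D)
    (A : EuclideanSpace ℂ Q →ₗ[ℂ] EuclideanSpace ℂ Q) :
    ∃ m, ActsOn D m (cellOp x A : Op L q₀) := by
  classical
  refine ⟨fun b a => ∑ r, if b = Function.update a ⟨x, hx⟩ r then A (siteKet (a ⟨x, hx⟩)) r else 0,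
    fun a w => ?_⟩
  have h1 : ∀ r, setAt (glue D a w) x r = glue D (Function.update a ⟨x, hx⟩ r) w := fun r => by
    refine Subtype.ext (funext fun z => ?_)
    by_cases hz : z = x
    · subst hz; simp [setAt, glue, hx]
    · by_cases hzD : z ∈ D
      · simp [setAt, glue, hz, hzD, Function.update_apply]
      · simp [setAt, glue, hz, hzD]
  have h2 : (glue D a w).1 x = a ⟨x, hx⟩ := by simp [glue, hx]
  rw [cellOp_ket]
  simp only [h1, h2, Finset.sum_smul, ite_smul, zero_smul]
  rw [Finset.sum_comm]
  simp

/-- The expectation value of an operator on the cells in `D` depends only on the restriction of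
the state to `D`. -/
theorem tsum_inner_of_actsOn {D : Finset L} {m : Matrix (D → Q) (D → Q) ℂ} {X C : Op L q₀}
    (hX : ActsOn D m X) (hC : Summable fun c : Config L q₀ => ‖C (ket c)‖ ^ 2) :
    ∑' c : Config L q₀, ⟪C (ket c), C (X (ket c))⟫_ℂ =
      ∑ a, ∑ b, m b a * restrict D (ContinuousLinearMap.adjoint C ∘L C) a b := by
  have hs : Summable fun c : Config L q₀ => ⟪C (ket c), C (X (ket c))⟫_ℂ :=
    summable_inner_of_norm_sq hC (summable_norm_sq_comp_l2ket X hC)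
  have hsg : ∀ a : D → Q, Summable fun w : Config {x // x ∉ D} q₀ => ‖C (ket (glue D a w))‖ ^ 2 :=
    fun a => hC.comp_injective (i := fun w => glue D a w) fun w w' h => by
      have := (glueEquiv q₀ D).injective (a₁ := (a, w)) (a₂ := (a, w')) h
      exact (Prod.ext_iff.1 this).2
  have hs' : Summable fun p : (D → Q) × Config {x // x ∉ D} q₀ =>
      ⟪C (ket (glueEquiv q₀ D p)), C (X (ket (glueEquiv q₀ D p)))⟫_ℂ :=
    (glueEquiv q₀ D).summable_iff.2 hs
  rw [← (glueEquiv q₀ D).tsum_eq, hs'.tsum_prod, tsum_fintype]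
  refine Finset.sum_congr rfl fun a _ => ?_
  have h1 : ∀ w : Config {x // x ∉ D} q₀,
      ⟪C (ket (glueEquiv q₀ D (a, w))), C (X (ket (glueEquiv q₀ D (a, w))))⟫_ℂ =
        ∑ b, m b a * ⟪C (ket (glue D a w)), C (ket (glue D b w))⟫_ℂ := fun w => by
    change ⟪C (ket (glue D a w)), C (X (ket (glue D a w)))⟫_ℂ = _
    rw [hX a w, map_sum, inner_sum]
    simp only [map_smul, inner_smul_right]
  simp only [h1]
  rw [Summable.tsum_finsetSum fun b _ => (summable_inner_of_norm_sq (hsg a) (hsg b)).mul_left _]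
  refine Finset.sum_congr rfl fun b _ => ?_
  rw [tsum_mul_left]
  refine congrArg _ (tsum_congr fun w => ?_)
  rw [ContinuousLinearMap.comp_apply, ContinuousLinearMap.adjoint_inner_right]

open scoped Classical in
/-- The matrix units on a single cell, whose expectation values are the entries of the restriction
of a state to that cell, are operators on that cell. -/
theorem exists_actsOn_single (x : L) (a b : ({x} : Finset L) → Q) :
    ∃ A : EuclideanSpace ℂ Q →ₗ[ℂ] EuclideanSpace ℂ Q,
      ActsOn {x} (Matrix.single b a 1) (cellOp x A : Op L q₀) := by
  let x' : ({x} : Finset L) := ⟨x, Finset.mem_singleton_self x⟩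
  have hx' : ∀ z : ({x} : Finset L), z = x' := fun z =>
    Subtype.ext (Finset.mem_singleton.1 z.2)
  have hext : ∀ a b : ({x} : Finset L) → Q, a = b ↔ a x' = b x' := fun a b =>
    ⟨fun h => by rw [h], fun h => funext fun z => by rw [hx' z, h]⟩
  refine ⟨(innerSL ℂ (siteKet (a x'))).toLinearMap.smulRight (siteKet (b x')), fun a' w => ?_⟩
  have h1 : setAt (glue {x} a' w) x (b x') = glue {x} b w := by
    refine Subtype.ext (funext fun z => ?_)
    by_cases hz : z = x
    · subst hz; simp [setAt, glue, x']
    · simp [setAt, glue, hz]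
  have h2 : (glue {x} a' w).1 x = a' x' := by simp [glue, x']
  rw [cellOp_ket, h2, Finset.sum_eq_single (b x'), Finset.sum_eq_single b, h1]
  · simp [inner_siteKet_left, siteKet_apply, Matrix.single_apply, hext]
    split_ifs <;> simp [siteKet_apply]
  · intro b' _ hb'
    simp [hb'.symm]
  · simp
  · intro r _ hr
    simp [siteKet_apply, hr]
  · simp

/-- An operator `R` is causal as soon as every `R† A R`, with `A` on the cell `x`, acts on the
neighborhood of `x` only. -/
theorem isCausal_of_actsOn {n : ℕ} {q₀ : Q} {N : Finset (Fin n → ℤ)} {R : Op (Fin n → ℤ) q₀}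
    (hU : R ∈ unitary (Op (Fin n → ℤ) q₀))
    (h : ∀ (x : Fin n → ℤ) (A : EuclideanSpace ℂ Q →ₗ[ℂ] EuclideanSpace ℂ Q),
      ∃ m X, ActsOn (nbhd N x) m X ∧ cellOp x A * R = R * X) : IsCausal N R := by
  classical
  have key : ∀ (x : Fin n → ℤ) (a b : ({x} : Finset (Fin n → ℤ)) → Q),
      ∃ m : Matrix (nbhd N x → Q) (nbhd N x → Q) ℂ, ∀ ρ : Op (Fin n → ℤ) q₀, IsDensity ρ →
        restrict {x} (R ∘L ρ ∘L ContinuousLinearMap.adjoint R) a b =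
          ∑ a', ∑ b', m b' a' * restrict (nbhd N x) ρ a' b' := by
    intro x a b
    obtain ⟨A, hA⟩ := exists_actsOn_single (q₀ := q₀) x a b
    obtain ⟨m, X, hX, hRX⟩ := h x A
    refine ⟨m, fun ρ hρ => ?_⟩
    obtain ⟨B, rfl, hB⟩ := exists_sqrt_of_isDensity hρ
    have h1 : ContinuousLinearMap.adjoint R * cellOp x A = X * ContinuousLinearMap.adjoint R := by
      have h2 := congrArg (fun T => star R * T * star R) hRX
      simp only [← mul_assoc, Unitary.star_mul_self_of_mem hU, one_mul] at h2
      rwa [mul_assoc, Unitary.mul_star_self_of_mem hU, mul_one] at h2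
    -- `tr (A R ρ R†) = tr (X ρ)`, where `ρ = B† B` and `R† A = X R†`.
    let U : ConfigSpace (Fin n → ℤ) q₀ ≃ₗᵢ[ℂ] ConfigSpace (Fin n → ℤ) q₀ :=
      Unitary.linearIsometryEquiv ⟨star R, Unitary.star_mem hU⟩
    have hUa : ∀ f, U f = ContinuousLinearMap.adjoint R f := fun f => rfl
    have e1 := tsum_inner_of_actsOn hA (C := B ∘L ContinuousLinearMap.adjoint R)
      (summable_norm_sq_comp_l2ket _ hB)
    have e2 := tsum_inner_of_actsOn hX hB
    have e3 := tsum_inner_unitary (C := B ∘L X) U hB (summable_norm_sq_comp_l2ket X hB)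
    rw [← e2]
    refine Eq.trans ?_ e3
    have e4 : ∑ a', ∑ b', (Matrix.single b a (1 : ℂ)) b' a' * restrict {x}
        (ContinuousLinearMap.adjoint (B ∘L ContinuousLinearMap.adjoint R) ∘L
          (B ∘L ContinuousLinearMap.adjoint R)) a' b' =
        restrict {x} (R ∘L (ContinuousLinearMap.adjoint B ∘L B) ∘L
          ContinuousLinearMap.adjoint R) a b := by
      rw [ContinuousLinearMap.adjoint_comp, ContinuousLinearMap.adjoint_adjoint]
      rw [Finset.sum_eq_single a, Finset.sum_eq_single b]
      · simp [ContinuousLinearMap.comp_assoc]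
      · intro b' _ hb'
        simp [hb'.symm]
      · simp
      · intro a' _ ha'
        simp [ha'.symm]
      · simp
    rw [← e4, ← e1]
    refine tsum_congr fun c => ?_
    have h2 := congrArg (fun T => T (ket c)) h1
    simp only [mul_apply_eq_comp] at h2
    simp only [ContinuousLinearMap.comp_apply, hUa, h2]
  intro ρ ρ' hρ hρ' x hx
  ext a b
  obtain ⟨m, hm⟩ := key x a b
  rw [hm ρ hρ, hm ρ' hρ', hx]

end Locality

/-! ### Products of operators on the components -/

section ComponentSpan

variable {ι : Type*} [Fintype ι] [DecidableEq ι] (d : ι → ℕ)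

theorem onComponent_matrixUnit (y : ι) (m m' k : Label d) :
    onComponent d y (ofColumns fun j => if j = m' y then siteKet (m y) else 0) (siteKet k) =
      if k y = m' y then siteKet (Function.update k y (m y)) else 0 := by
  rw [onComponent_siteKet, ofColumns_siteKet, Finset.sum_eq_single (m y)]
  · split_ifs <;> simp [siteKet_apply]
  · intro i _ hi
    split_ifs <;> simp [siteKet_apply, hi]
  · simp

/-- The product over the components in `l` of the matrix units `|m y⟩⟨m' y|`. -/
theorem list_prod_matrixUnit (m m' k : Label d) {l : List ι} (hl : l.Nodup) :
    (l.map fun y => (onComponent d y (ofColumns fun j => if j = m' y then siteKet (m y) else 0) :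
      Module.End ℂ (CellSpace d))).prod (siteKet k) =
      if ∀ y ∈ l, k y = m' y then siteKet (fun y => if y ∈ l then m y else k y) else 0 := by
  induction l with
  | nil => simp
  | cons y l ih =>
    rw [List.nodup_cons] at hl
    rw [List.map_cons, List.prod_cons, Module.End.mul_apply, ih hl.2]
    by_cases h : ∀ z ∈ l, k z = m' z
    · rw [if_pos h, onComponent_matrixUnit, if_neg hl.1]
      by_cases hy : k y = m' y
      · rw [if_pos hy, if_pos (by simpa [hy] using h)]
        congr 1
        funext z
        by_cases hz : z = y
        · subst hz; simp
        · simp [hz]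
      · rw [if_neg hy, if_neg fun h' => hy (h' y (by simp))]
    · rw [if_neg h, if_neg fun h' => h fun z hz => h' z (by simp [hz]), map_zero]

/-- Matrix units on a tensor product are products of matrix units on the factors, so products of
operators on the components span all operators. -/
theorem mem_span_list_prod_onComponent {l : List ι} (hl : l.Nodup) (hmem : ∀ y, y ∈ l)
    (X : Module.End ℂ (CellSpace d)) :
    X ∈ Submodule.span ℂ {Y : Module.End ℂ (CellSpace d) |
      ∃ e : (y : ι) → Component d y →ₗ[ℂ] Component d y,
        Y = (l.map fun y => (onComponent d y (e y) : Module.End ℂ (CellSpace d))).prod} := by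
  have hX : X = ∑ m' : Label d, ∑ m : Label d, X (siteKet m') m •
      (l.map fun y => (onComponent d y (ofColumns fun j => if j = m' y then siteKet (m y) else 0) :
        Module.End ℂ (CellSpace d))).prod := by
    refine linearMap_ext_siteKet fun k => ?_
    simp only [LinearMap.sum_apply, LinearMap.smul_apply, list_prod_matrixUnit d _ _ _ hl, hmem,
      if_true, forall_const, ← funext_iff]
    rw [Finset.sum_eq_single k]
    · simpa using eq_sum_siteKet (X (siteKet k))
    · intro m' _ hm'
      simp [hm'.symm]
    · simp
  rw [hX]
  exact Submodule.sum_mem _ fun m' _ => Submodule.sum_mem _ fun m _ =>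
    Submodule.smul_mem _ _ (Submodule.subset_span ⟨_, rfl⟩)

end ComponentSpan

/-! ### Lattice gases are quantum cellular automata -/

section Translations

variable {n : ℕ}

theorem translation_cellwise {Q Q' : Type*} [Fintype Q] [Fintype Q'] {q₀ : Q} {q₀' : Q'}
    (U : EuclideanSpace ℂ Q ≃ₗᵢ[ℂ] EuclideanSpace ℂ Q') (hU : U (siteKet q₀) = siteKet q₀')
    (z : Fin n → ℤ) (f : ConfigSpace (Fin n → ℤ) q₀) :
    translation q₀' z (cellwise (Fin n → ℤ) U hU f) =
      cellwise (Fin n → ℤ) U hU (translation q₀ z f) := by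
  have key : (translation q₀' z).toContinuousLinearEquiv.toContinuousLinearMap.comp
        (cellwise (Fin n → ℤ) U hU).toContinuousLinearEquiv.toContinuousLinearMap =
      (cellwise (Fin n → ℤ) U hU).toContinuousLinearEquiv.toContinuousLinearMap.comp
        (translation q₀ z).toContinuousLinearEquiv.toContinuousLinearMap := by
    refine clm_ext_l2ket fun c => ?_
    change translation q₀' z (cellwise (Fin n → ℤ) U hU (ket c)) =
      cellwise (Fin n → ℤ) U hU (translation q₀ z (ket c))
    rw [translation_ket, cellwise_ket, cellwise_ket]
    exact translation_prodVec z _ _ _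
  exact congrArg (fun T => T f) key

theorem translation_propagation {N : Finset (Fin n → ℤ)} {K : N → Type*} (k₀ : (z : N) → K z)
    (z : Fin n → ℤ) (f : ConfigSpace (Fin n → ℤ) k₀) :
    translation k₀ z (propagation k₀ f) = propagation k₀ (translation k₀ z f) := by
  have key : (translation k₀ z).toContinuousLinearEquiv.toContinuousLinearMap.comp
        (propagation k₀).toContinuousLinearEquiv.toContinuousLinearMap =
      (propagation k₀).toContinuousLinearEquiv.toContinuousLinearMap.comp
        (translation k₀ z).toContinuousLinearEquiv.toContinuousLinearMap := by
    refine clm_ext_l2ket fun c => ?_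
    change permUnitary _ (permUnitary _ (l2ket c)) = permUnitary _ (permUnitary _ (l2ket c))
    rw [permUnitary_ket, permUnitary_ket, permUnitary_ket, permUnitary_ket]
    refine congrArg l2ket (Subtype.ext (funext fun x => funext fun w => ?_))
    change c.1 (x + z + w) w = c.1 (x + w + z) w
    rw [add_right_comm]
  exact congrArg (fun T => T f) key

/-- Propagation moves operators on the component `y` of the cell `x + y` to the cell `x`. -/
theorem propagation_cellOp {N : Finset (Fin n → ℤ)} {d : N → ℕ} (k₀ : Label d) (x : Fin n → ℤ)
    (y : N) (e : Component d y →ₗ[ℂ] Component d y) (f : ConfigSpace (Fin n → ℤ) k₀) :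
    propagation k₀ (cellOp (x + y) (onComponent d y e) f) =
      cellOp x (onComponent d y e) (propagation k₀ f) := by
  have hop : ∀ (x : Fin n → ℤ) (c : Config (Fin n → ℤ) k₀),
      cellOp x (onComponent d y e) (ket c) =
        ∑ i, e (siteKet (c.1 x y)) i • ket (setAt c x (Function.update (c.1 x) y i)) := by
    intro x c
    rw [cellOp_ket, onComponent_siteKet]
    simp only [WithLp.ofLp_sum, WithLp.ofLp_smul, Finset.sum_apply, Pi.smul_apply, siteKet_apply,
      Finset.sum_smul, smul_eq_mul, mul_ite, mul_one, mul_zero, ite_smul, zero_smul]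
    rw [Finset.sum_comm]
    simp
  have key : (propagation k₀).toContinuousLinearEquiv.toContinuousLinearMap.comp
        (cellOp (x + y) (onComponent d y e)) =
      (cellOp x (onComponent d y e)).comp
        (propagation k₀).toContinuousLinearEquiv.toContinuousLinearMap := by
    refine clm_ext_l2ket fun c => ?_
    change propagation k₀ (cellOp (x + y) (onComponent d y e) (ket c)) =
      cellOp x (onComponent d y e) (propagation k₀ (ket c))
    have hp : ∀ c : Config (Fin n → ℤ) k₀, propagation k₀ (ket c) = ket (propagate k₀ c) :=
      fun c => permUnitary_ket _ _
    rw [hop, hp, hop, map_sum]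
    refine Finset.sum_congr rfl fun i _ => ?_
    rw [map_smul, hp]
    refine congrArg (fun c' : Config (Fin n → ℤ) k₀ => e (siteKet (c.1 (x + y) y)) i • ket c')
      (Subtype.ext (funext fun z => funext fun w => ?_))
    change Function.update c.1 (x + y) (Function.update (c.1 (x + y)) y i) (z + w) w =
      Function.update (fun z w => c.1 (z + w.1) w) x
        (Function.update (fun w : N => c.1 (x + w) w) y i) z w
    by_cases hz : z = x
    · subst hz
      rw [Function.update_self]
      by_cases hw : w = y
      · subst hw; simp
      · have : z + (w : Fin n → ℤ) ≠ z + y := fun h => hw (Subtype.ext (add_left_cancel h))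
        rw [Function.update_of_ne this, Function.update_of_ne hw]
    · rw [Function.update_of_ne hz]
      by_cases hx : z + (w : Fin n → ℤ) = x + y
      · have hw : w ≠ y := fun h => hz (by
          subst h
          exact add_right_cancel hx)
        rw [hx, Function.update_self, Function.update_of_ne hw]
      · rw [Function.update_of_ne hx]
  exact congrArg (fun T => T f) key

end Translations

section LatticeGas

variable {n : ℕ} {Q : Type*} [Fintype Q] {q₀ : Q} {N : Finset (Fin n → ℤ)}
  {R : Op (Fin n → ℤ) q₀} {d : N → ℕ} {k₀ : Label d}
  {S : EuclideanSpace ℂ Q ≃ₗᵢ[ℂ] CellSpace d} {hS : S (siteKet q₀) = siteKet k₀}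
  {F : CellSpace d ≃ₗᵢ[ℂ] CellSpace d} {hF : F (siteKet k₀) = siteKet k₀} {phase : ℂ}

theorem mem_unitary_of_eq_smul {ι : Type*}
    {T : lp (fun _ : ι => ℂ) 2 →L[ℂ] lp (fun _ : ι => ℂ) 2}
    (U : lp (fun _ : ι => ℂ) 2 ≃ₗᵢ[ℂ] lp (fun _ : ι => ℂ) 2) {phase : ℂ} (hphase : ‖phase‖ = 1)
    (hT : ∀ f, T f = phase • U f) :
    T ∈ unitary (lp (fun _ : ι => ℂ) 2 →L[ℂ] lp (fun _ : ι => ℂ) 2) := by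
  have hph : star phase * phase = 1 := by
    rw [Complex.star_def, ← Complex.normSq_eq_conj_mul_self, Complex.normSq_eq_norm_sq, hphase]
    simp
  have hT' : T = phase • (Unitary.linearIsometryEquiv.symm U).1 :=
    ContinuousLinearMap.ext fun f => hT f
  rw [hT', Unitary.mem_iff]
  constructor
  · rw [star_smul, smul_mul_smul_comm, hph,
      Unitary.star_mul_self_of_mem (Unitary.linearIsometryEquiv.symm U).2, one_smul]
  · rw [star_smul, smul_mul_smul_comm, mul_comm, hph,
      Unitary.mul_star_self_of_mem (Unitary.linearIsometryEquiv.symm U).2, one_smul]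

/-- The homomorphism that embeds the operators on `Ŵ`, transported to `W` along a unitary `S`, as
the operators on the cell `x`. -/
def conjCellHom (q₀ : Q) (S : EuclideanSpace ℂ Q ≃ₗᵢ[ℂ] CellSpace d) (x : Fin n → ℤ) :
    Module.End ℂ (CellSpace d) →ₐ[ℂ] Op (Fin n → ℤ) q₀ :=
  (cellHom q₀ x).comp (AlgHom.ofLinearMap
    { toFun := fun A =>
        S.symm.toLinearEquiv.toLinearMap ∘ₗ A ∘ₗ S.toLinearEquiv.toLinearMap
      map_add' := fun A B => by
        refine LinearMap.ext fun v => ?_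
        simp
      map_smul' := fun a A => by
        refine LinearMap.ext fun v => ?_
        simp }
    (LinearMap.ext fun v => by simp)
    (fun A B => LinearMap.ext fun v => by simp))

theorem conjCellHom_apply (S : EuclideanSpace ℂ Q ≃ₗᵢ[ℂ] CellSpace d) (x : Fin n → ℤ)
    (A : Module.End ℂ (CellSpace d)) :
    conjCellHom q₀ S x A = cellOp x (S.symm.toLinearEquiv.toLinearMap ∘ₗ A ∘ₗ
      S.toLinearEquiv.toLinearMap) := rfl

theorem exists_conjCellHom_eq (S : EuclideanSpace ℂ Q ≃ₗᵢ[ℂ] CellSpace d) (x : Fin n → ℤ)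
    (A : EuclideanSpace ℂ Q →ₗ[ℂ] EuclideanSpace ℂ Q) :
    ∃ X, conjCellHom q₀ S x X = cellOp x A := by
  refine ⟨S.toLinearEquiv.toLinearMap ∘ₗ A ∘ₗ S.symm.toLinearEquiv.toLinearMap, ?_⟩
  rw [conjCellHom_apply]
  congr 1
  refine LinearMap.ext fun v => ?_
  simp

/-- The local condition follows once the algebras `𝒟_{x-y,x}` are the full operator algebras of the
tensor factors of the cell. -/
theorem localCondition_of_localPiece_eq
    (h : ∀ (x : Fin n → ℤ) (y : N), localPiece R (x - y) x =
      {T | ∃ e : Component d y →ₗ[ℂ] Component d y,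
        T = cellOp x (S.symm.toLinearEquiv.toLinearMap ∘ₗ onComponent d y e ∘ₗ
          S.toLinearEquiv.toLinearMap)}) : LocalCondition N R := by
  classical
  intro x
  ext T
  rw [SetLike.mem_coe]
  constructor
  · rintro ⟨A, rfl⟩
    obtain ⟨X, hX⟩ := exists_conjCellHom_eq (q₀ := q₀) S x A
    rw [← hX]
    have hspan := Submodule.mem_map_of_mem (f := (conjCellHom q₀ S x).toLinearMap)
      (mem_span_list_prod_onComponent d (nodup_nbhdList N) mem_nbhdList X)
    rw [Submodule.map_span] at hspan
    refine Submodule.span_mono ?_ hspan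
    rintro _ ⟨_, ⟨e, rfl⟩, rfl⟩
    refine ⟨fun y => if hy : y ∈ N then conjCellHom q₀ S x (onComponent d ⟨y, hy⟩ (e ⟨y, hy⟩))
      else 1, fun y hy => ?_, ?_⟩
    · simp only [dif_pos hy]
      rw [h x ⟨y, hy⟩]
      exact ⟨_, rfl⟩
    · rw [← nbhdList_map_val, List.map_map, AlgHom.toLinearMap_apply, map_list_prod, List.map_map]
      refine congrArg List.prod (List.map_congr_left fun y _ => ?_)
      simp
  · intro hT
    have hle : Submodule.span ℂ {T : Op (Fin n → ℤ) q₀ | ∃ t : (Fin n → ℤ) → Op (Fin n → ℤ) q₀,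
        (∀ y ∈ N, t y ∈ localPiece R (x - y) x) ∧ T = (N.toList.map t).prod} ≤
        Subalgebra.toSubmodule (cellHom q₀ x).range := by
      refine Submodule.span_le.2 ?_
      rintro _ ⟨t, ht, rfl⟩
      refine Subalgebra.list_prod_mem _ fun T hT => ?_
      obtain ⟨y, hy, rfl⟩ := List.mem_map.1 hT
      obtain ⟨A, hA⟩ := (ht y (Finset.mem_toList.1 hy)).2
      exact ⟨A, hA⟩
    obtain ⟨A, hA⟩ := hle hT
    exact ⟨A, hA⟩

theorem isTranslationInvariant_of_latticeGas
    (hR : ∀ f : ConfigSpace (Fin n → ℤ) q₀,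
      R f = phase • (cellwise (Fin n → ℤ) S hS).symm (cellwise (Fin n → ℤ) F hF (propagation k₀
        (cellwise (Fin n → ℤ) S hS f)))) :
    IsTranslationInvariant R := by
  have hS' : S.symm (siteKet k₀) = siteKet q₀ := by rw [← hS, S.symm_apply_apply]
  intro z f
  obtain ⟨g, rfl⟩ := (translation q₀ z).surjective f
  rw [LinearIsometryEquiv.symm_apply_apply, hR, hR, map_smul, cellwise_symm S hS hS',
    translation_cellwise, translation_cellwise, translation_propagation, translation_cellwise]

/-- `R` carries an operator on the component `y` of the cell `x + y` to the cell `x`, where the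
collision conjugates it by `F`. -/
theorem conjCellHom_mul_of_latticeGas
    (hR : ∀ f : ConfigSpace (Fin n → ℤ) q₀,
      R f = phase • (cellwise (Fin n → ℤ) S hS).symm (cellwise (Fin n → ℤ) F hF (propagation k₀
        (cellwise (Fin n → ℤ) S hS f))))
    (x : Fin n → ℤ) (y : N) (e : Component d y →ₗ[ℂ] Component d y) :
    conjCellHom q₀ (S.trans F.symm) x (onComponent d y e) * R =
      R * conjCellHom q₀ S (x + y) (onComponent d y e) := by
  have hS' : S.symm (siteKet k₀) = siteKet q₀ := by rw [← hS, S.symm_apply_apply]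
  refine ContinuousLinearMap.ext fun f => ?_
  rw [mul_apply_eq_comp, mul_apply_eq_comp, hR, hR, map_smul, conjCellHom_apply, conjCellHom_apply,
    cellwise_cellOp S hS (x + y) _ (onComponent d y e) (fun v => by simp), propagation_cellOp,
    cellwise_cellOp F hF x _ (F.toLinearEquiv.toLinearMap ∘ₗ onComponent d y e ∘ₗ
      F.symm.toLinearEquiv.toLinearMap) (fun v => by simp), cellwise_symm S hS hS',
    cellwise_cellOp S.symm hS' x _ ((S.trans F.symm).symm.toLinearEquiv.toLinearMap ∘ₗ
      onComponent d y e ∘ₗ (S.trans F.symm).toLinearEquiv.toLinearMap) (fun v => by simp)]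

/-- A lattice gas is causal: `R† A R`, for `A` on the cell `x`, is a combination of products of
operators on the components `y` of the cells `x + y`. -/
theorem isCausal_of_latticeGas (hU : R ∈ unitary (Op (Fin n → ℤ) q₀))
    (hR : ∀ f : ConfigSpace (Fin n → ℤ) q₀,
      R f = phase • (cellwise (Fin n → ℤ) S hS).symm (cellwise (Fin n → ℤ) F hF (propagation k₀
        (cellwise (Fin n → ℤ) S hS f)))) : IsCausal N R := by
  classical
  refine isCausal_of_actsOn hU fun x A => ?_
  obtain ⟨B, hB⟩ := exists_conjCellHom_eq (q₀ := q₀) (S.trans F.symm) x A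
  rw [← hB]
  clear hB
  induction mem_span_list_prod_onComponent d (nodup_nbhdList N) mem_nbhdList B
    using Submodule.span_induction with
  | zero =>
    refine ⟨(0 : ℂ) • 1, (0 : ℂ) • 1, (actsOn_one _).smul 0, ?_⟩
    rw [map_zero, zero_mul, zero_smul, mul_zero]
  | add B B' _ _ h h' =>
    obtain ⟨m, X, hX, hXR⟩ := h
    obtain ⟨m', X', hX', hXR'⟩ := h'
    exact ⟨_, _, hX.add hX', by rw [map_add, add_mul, mul_add, hXR, hXR']⟩
  | smul a B _ h =>
    obtain ⟨m, X, hX, hXR⟩ := h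
    exact ⟨_, _, hX.smul a, by rw [map_smul, smul_mul_assoc, mul_smul_comm, hXR]⟩
  | mem B hB =>
    obtain ⟨e, rfl⟩ := hB
    induction nbhdList N with
    | nil => exact ⟨_, _, actsOn_one _, by simp⟩
    | cons y l ih =>
      obtain ⟨m, X, hX, hXR⟩ := ih
      have hmem : x + (y : Fin n → ℤ) ∈ nbhd N x :=
        Finset.mem_image.2 ⟨y, y.2, add_comm _ _⟩
      obtain ⟨m', hm'⟩ := exists_actsOn_cellOp (q₀ := q₀) (nbhd N x) hmem
        (S.symm.toLinearEquiv.toLinearMap ∘ₗ onComponent d y (e y) ∘ₗ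
          S.toLinearEquiv.toLinearMap)
      refine ⟨_, _, hm'.mul hX, ?_⟩
      rw [List.map_cons, List.prod_cons, map_mul, mul_assoc, hXR, ← mul_assoc, ← mul_assoc,
        conjCellHom_mul_of_latticeGas hR, conjCellHom_apply]

end LatticeGas

end QCA

end

theorem mainTheorem1 {n : ℕ} (hn : 0 < n) {Q : Type*} [Fintype Q] (q₀ : Q)
    (N : Finset (Fin n → ℤ)) (R : QCA.Op (Fin n → ℤ) q₀) :
    (QCA.IsQCA N R ∧ QCA.LocalCondition N R) ↔
      ∃ (d : N → ℕ) (k₀ : QCA.Label d)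
        (S : EuclideanSpace ℂ Q ≃ₗᵢ[ℂ] QCA.CellSpace d)
        (hS : S (QCA.siteKet q₀) = QCA.siteKet k₀)
        (F : QCA.CellSpace d ≃ₗᵢ[ℂ] QCA.CellSpace d)
        (hF : F (QCA.siteKet k₀) = QCA.siteKet k₀)
        (phase : ℂ),
        (∀ (x : Fin n → ℤ) (y : N), QCA.localPiece R (x - y) x =
          {T | ∃ e : QCA.Component d y →ₗ[ℂ] QCA.Component d y,
            T = QCA.cellOp x (S.symm.toLinearEquiv.toLinearMap ∘ₗ QCA.onComponent d y e ∘ₗ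
              S.toLinearEquiv.toLinearMap)}) ∧
        ‖phase‖ = 1 ∧
        R (QCA.ket (QCA.vac (Fin n → ℤ) q₀)) = phase • QCA.ket (QCA.vac (Fin n → ℤ) q₀) ∧
        ∀ f : QCA.ConfigSpace (Fin n → ℤ) q₀,
          R f = phase • (QCA.cellwise (Fin n → ℤ) S hS).symm
            (QCA.cellwise (Fin n → ℤ) F hF (QCA.propagation k₀
              (QCA.cellwise (Fin n → ℤ) S hS f))) := by
  constructor
  · rintro ⟨hQ, hL⟩
    exact QCA.exists_latticeGas hn hQ.isUnitary hQ.translationInvariant hL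
  · rintro ⟨d, k₀, S, hS, F, hF, phase, hD, hphase, -, hR⟩
    have hU := QCA.mem_unitary_of_eq_smul (((((QCA.cellwise (Fin n → ℤ) S hS).trans
      (QCA.propagation k₀)).trans (QCA.cellwise (Fin n → ℤ) F hF)).trans
        (QCA.cellwise (Fin n → ℤ) S hS).symm)) hphase hR
    exact ⟨⟨hU, QCA.isTranslationInvariant_of_latticeGas hR, QCA.isCausal_of_latticeGas hU hR⟩,
      QCA.localCondition_of_localPiece_eq hD⟩
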